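/- Let $d\ge 2$ and $a>0$. For a finite set $\Lambda\subset\mathbb Z^d$ and $\varphi\in\mathbb R^{\Lambda}$, extended by $\varphi_x=0$ for $x\notin\Lambda$, let $$\mathcal H_\Lambda(\varphi)=\frac1{4d}\sum_{\{x,y\}:\ x\sim y,\ \{x,y\}\cap\Lambda\ne\varnothing}(\varphi_x-\varphi_y)^2,$$ where the sum is over unoriented nearest-neighbour edges of $\mathbb Z^d$. For $b,h\in\mathbb R$ and an environment $\mathbf e=(e_x)_{x\in\mathbb Z^d}$ set $$Z^{\mathbf e}_\Lambda=\int_{\mathbb R^\Lambda}\exp\Big(-\mathcal H_\Lambda(\varphi)+\sum_{x\in\Lambda}(b\,e_x+h)\mathbf 1_{\{\varphi_x\in[-a,a]\}}\Big)\prod_{x\in\Lambda}d\varphi_x ,$$ let $Z^0_\Lambda=\int_{\mathbb R^\Lambda}e^{-\mathcal H_\Lambda(\varphi)}\prod_{x\in\Lambda}d\varphi_x$, and, with $\Lambda_n=\{0,\dots,n-1\}^d$, let $f^{\mathbf q}_n(\mathbf e)=n^{-d}\log(Z^{\mathbf e}_{\Lambda_n}/Z^0_{\Lambda_n})$. Let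 the $e_x$ be i.i.d. with $P(e_x=1)=P(e_x=-1)=\tfrac12$. The quenched free energy $f^{\mathbf q}=f^{\mathbf q}(b,h)$ is the deterministic almost sure limit of $f^{\mathbf q}_n(\mathbf e)$ as $n\to\infty$, and the quenched critical line is $h^{\mathbf q}_c(b)=\sup\{h\in\mathbb R: f^{\mathbf q}(b,h)=0\}$, $b>0$. Then $h_c^{\mathbf q}(b)$ is finite and $h^{\mathbf q}_c(b)<0$ for every $b>0$. More precisely, there are constants $C,C'>0$ depending only on $d$ and $a$, and $\epsilon\in(0,1)$ (which may also depend on $d$ and $a$), such that for all $b,h\in\mathbb R$ with $b+h>0$, $-\epsilon<-b+h<0$ and $$\begin{cases} h>\dfrac{C'(-b+h)^2}{\log(b-h)} & \text{if } d=2,\\[2mm] h>-C\,(-b+h)^2 & \text{if } d\ge 3,\end{cases}$$ the quenched free energy exists (the almost sure limit above) and $f^{\mathbf q}(b,h)>0$. -/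

import Mathlib

open MeasureTheory Filter Topology

noncomputable section

namespace PinnedGFF

/-- The sites of the lattice `ℤ^d`. -/
abbrev Site (d : ℕ) : Type := Fin d → ℤ

/-- The box `Λ_n = {0, …, n-1}^d`. -/
def box (d n : ℕ) : Finset (Site d) :=
  Fintype.piFinset fun _ : Fin d => Finset.Ico (0 : ℤ) (n : ℤ)

/-- The height configuration on all of `ℤ^d` that equals `φ` on `Λ` and `0` outside `Λ`. -/
def extendZero {d : ℕ} (Λ : Finset (Site d)) (φ : Λ → ℝ) (x : Site d) : ℝ :=
  if hx : x ∈ Λ then φ ⟨x, hx⟩ else 0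

/-- The Hamiltonian `(1/(4d)) ∑ (φ_x - φ_y)²` over the nearest neighbour edges `{x, y}` of `ℤ^d`
which meet `Λ`. Every (unoriented) edge is written in exactly one way as `{x, x + u_i}` with `u_i`
a standard unit vector, and it meets `Λ` iff `x ∈ Λ` or `x ∈ Λ - u_i`. -/
def hamiltonian {d : ℕ} (Λ : Finset (Site d)) (φ : Site d → ℝ) : ℝ :=
  (1 / (4 * (d : ℝ))) *
    ∑ i : Fin d, ∑ x ∈ Λ ∪ Λ.image (fun y => y - Pi.single i (1 : ℤ)),
      (φ x - φ (x + Pi.single i (1 : ℤ))) ^ 2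

/-- The partition function in `Λ`, with `0` boundary condition and inverse temperature `1`, of the
free field with the square-well potential of strength `v x` at `x`, supported on heights in
`[-a, a]`. -/
def partitionFunction {d : ℕ} (Λ : Finset (Site d)) (a : ℝ) (v : Site d → ℝ) : ℝ :=
  ∫ φ : Λ → ℝ, Real.exp (-hamiltonian Λ (extendZero Λ φ) +
    ∑ x : Λ, v x * (Set.Icc (-a) a).indicator (fun _ => (1 : ℝ)) (φ x))

/-- The quenched free energy per site in `Λ` in the environment `e`:
`|Λ|⁻¹ log (Z^e_Λ / Z^0_Λ)`, where `Z^0_Λ` is the partition function without potential. -/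
def finiteFreeEnergy {d : ℕ} (Λ : Finset (Site d)) (a b h : ℝ) (e : Site d → ℝ) : ℝ :=
  (Λ.card : ℝ)⁻¹ *
    Real.log (partitionFunction Λ a (fun x => b * e x + h) / partitionFunction Λ a (fun _ => 0))

/-- The law giving mass `1/2` to each of `-1` and `+1`. -/
def signLaw : Measure ℝ :=
  ProbabilityTheory.bernoulliMeasure (-1 : ℝ) 1 ⟨1 / 2, by norm_num, by norm_num⟩

instance : IsProbabilityMeasure signLaw := by
  unfold signLaw; infer_instance

/-- The law of the environment: independent fair signs at the sites of `ℤ^d`. -/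
def envLaw (d : ℕ) : Measure (Site d → ℝ) :=
  Measure.infinitePi fun _ : Site d => signLaw

/-- `f` is the quenched free energy: for almost every environment the free energy per site in
`Λ_n` converges to the deterministic number `f`. -/
def IsQuenchedFreeEnergy (d : ℕ) (a b h f : ℝ) : Prop :=
  ∀ᵐ e ∂(envLaw d), Tendsto (fun n : ℕ => finiteFreeEnergy (box d n) a b h e) atTop (𝓝 f)

/-- `hc` is the quenched critical point at disorder intensity `b`: the supremum of all `h` at which
the quenched free energy vanishes. -/
def IsQuenchedCriticalPoint (d : ℕ) (a b hc : ℝ) : Prop :=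
  IsLUB {h : ℝ | IsQuenchedFreeEnergy d a b h 0} hc

end PinnedGFF

end

/-!
The argument compares the pinned field with free fields in finite boxes.

The measure `gff Λ` (the unnormalised free field) is handled through one identity,
`lintegral_gff_insert`: given the rest of the field, the height at a site is Gaussian with variance
one around the mean of its neighbours. Writing `logRatio Λ a v = log (Z^v_Λ / Z^0_Λ)`, it controls
what happens when a site is added to a domain. The pinned partition function is multiplied by at
least a constant, by the symmetry `φ ↦ -φ` (`partitionFunction_insert_ge`), and the free one by at
most a constant times the square root of the distance from the site to the complement, by shifting
along a harmonic function (`exists_harmonic_shift`, `exists_height_law`). Hence whole walls of sites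
can be removed at constant cost per site (`logRatio_sdiff_le`). Boxes separated by walls are independent,
so the averaged logarithm `meanLog` is superadditive up to a surface term (`meanLog_box_ge`), and its
density converges (`tendsto_of_superadditive`). An Efron–Stein bound gives variance at most
`b ^ 2 / n ^ d` for the free energy in the box of side `n`, which is summable since `d ≥ 2`; so the
quenched free energy exists (`exists_quenchedFreeEnergy`).

Positivity comes from resampling. On a sublattice `T` without adjacent sites the heights are
conditionally independent, and integrating one of them out replaces `exp (v 1_{|φ_x| ≤ a})` by
`1 + p (exp v - 1)`, where `p` is the conditional probability of the well. Jensen's inequality for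
the remaining variables and the average over the sign of the environment yield a gain per visit to
the well of order `log (1 + p (1 - p) (2 cosh b - 2))`, quadratic in `b` (`meanGain_ge`,
`meanLog_ge`); it beats a mean `h` which is negative of order `b ^ 2`. A site of a box of side `L`
visits the well with probability at least of order `L ^ (-1/2)`, because the variance of its height
is at most of order `L` (`occupation_ge`). The total gain `L ^ (d - 1/2)` exceeds the cost
`L ^ (d - 1)` of the walls around the box for large `L`, in every dimension
(`exists_quenchedFreeEnergy_pos`). The logarithm allowed when `d = 2` is therefore not needed.

For `h ≤ -b` the potential is nonpositive, and lifting the field to a large constant height inside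
the box costs only a surface term and makes visits to the well rare (`logRatio_ge_of_shift`), so the
free energy vanishes. With monotonicity in `h` this makes the critical point finite and negative.
-/

open MeasureTheory Filter Topology ProbabilityTheory
open scoped ENNReal

noncomputable section

namespace PinnedGFF

variable {d : ℕ}

/-! ### The Dirichlet form -/

/-- The average of `φ` over the `2d` nearest neighbours of `x`. -/
def neighborMean (φ : Site d → ℝ) (x : Site d) : ℝ :=
  (1 / (2 * (d : ℝ))) * ∑ i : Fin d, (φ (x + Pi.single i 1) + φ (x - Pi.single i 1))

/-- The symmetric bilinear form polarising the Hamiltonian: `dform Λ φ φ = 2 * hamiltonian Λ φ`. -/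
def dform (Λ : Finset (Site d)) (φ ψ : Site d → ℝ) : ℝ :=
  (1 / (2 * (d : ℝ))) *
    ∑ i : Fin d, ∑ x ∈ Λ ∪ Λ.image (fun y => y - Pi.single i (1 : ℤ)),
      (φ x - φ (x + Pi.single i (1 : ℤ))) * (ψ x - ψ (x + Pi.single i (1 : ℤ)))

lemma hamiltonian_eq_dform (Λ : Finset (Site d)) (φ : Site d → ℝ) :
    hamiltonian Λ φ = dform Λ φ φ / 2 := by
  unfold hamiltonian dform
  simp only [← sq]
  ring

lemma hamiltonian_nonneg (Λ : Finset (Site d)) (φ : Site d → ℝ) : 0 ≤ hamiltonian Λ φ := by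
  unfold hamiltonian; positivity

lemma dform_comm (Λ : Finset (Site d)) (φ ψ : Site d → ℝ) : dform Λ φ ψ = dform Λ ψ φ := by
  simp only [dform, mul_comm]

lemma hamiltonian_add_smul (Λ : Finset (Site d)) (φ ψ : Site d → ℝ) (t : ℝ) :
    hamiltonian Λ (φ + t • ψ) =
      hamiltonian Λ φ + t * dform Λ φ ψ + t ^ 2 * hamiltonian Λ ψ := by
  simp only [hamiltonian, dform, Finset.mul_sum, ← Finset.sum_add_distrib]
  refine Finset.sum_congr rfl fun i _ => Finset.sum_congr rfl fun x _ => ?_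
  simp only [Pi.add_apply, Pi.smul_apply, smul_eq_mul]
  ring

lemma hamiltonian_neg (Λ : Finset (Site d)) (φ : Site d → ℝ) :
    hamiltonian Λ (-φ) = hamiltonian Λ φ := by
  simp only [hamiltonian, Pi.neg_apply]
  congr 1
  refine Finset.sum_congr rfl fun i _ => Finset.sum_congr rfl fun x _ => ?_
  ring

/-- Summation by parts. -/
lemma dform_eq_sum [NeZero d] {Λ : Finset (Site d)} {φ ψ : Site d → ℝ}
    (hψ : ∀ x ∉ Λ, ψ x = 0) :
    dform Λ φ ψ = ∑ x ∈ Λ, (φ x - neighborMean φ x) * ψ x := by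
  have hd : (d : ℝ) ≠ 0 := Nat.cast_ne_zero.mpr (NeZero.ne d)
  have key : ∀ i : Fin d, ∑ x ∈ Λ ∪ Λ.image (fun y => y - Pi.single i (1 : ℤ)),
      (φ x - φ (x + Pi.single i (1 : ℤ))) * (ψ x - ψ (x + Pi.single i (1 : ℤ))) =
      ∑ x ∈ Λ, (2 * φ x - (φ (x + Pi.single i 1) + φ (x - Pi.single i 1))) * ψ x := by
    intro i
    simp only [mul_sub, Finset.sum_sub_distrib]
    have h1 : ∑ x ∈ Λ ∪ Λ.image (fun y => y - Pi.single i (1 : ℤ)),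
        (φ x - φ (x + Pi.single i (1 : ℤ))) * ψ x =
        ∑ x ∈ Λ, (φ x - φ (x + Pi.single i (1 : ℤ))) * ψ x := by
      refine (Finset.sum_subset Finset.subset_union_left fun x _ hx => ?_).symm
      rw [hψ x hx, mul_zero]
    have h2 : ∑ x ∈ Λ ∪ Λ.image (fun y => y - Pi.single i (1 : ℤ)),
        (φ x - φ (x + Pi.single i (1 : ℤ))) * ψ (x + Pi.single i (1 : ℤ)) =
        ∑ x ∈ Λ, (φ (x - Pi.single i 1) - φ x) * ψ x := by
      trans ∑ x ∈ Λ.image (fun y => y - Pi.single i (1 : ℤ)),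
        (φ x - φ (x + Pi.single i (1 : ℤ))) * ψ (x + Pi.single i (1 : ℤ))
      · refine (Finset.sum_subset Finset.subset_union_right fun x _ hx => ?_).symm
        rw [hψ, mul_zero]
        intro h
        exact hx (Finset.mem_image.mpr ⟨_, h, by simp⟩)
      · rw [Finset.sum_image fun x _ y _ h => by simpa using h]
        simp
    rw [h1, h2, ← Finset.sum_sub_distrib]
    exact Finset.sum_congr rfl fun x _ => by ring
  unfold dform
  simp only [key]
  rw [Finset.sum_comm, Finset.mul_sum]
  refine Finset.sum_congr rfl fun x _ => ?_
  rw [← Finset.sum_mul, Finset.sum_sub_distrib]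
  simp only [neighborMean, Finset.sum_const, Finset.card_univ, Fintype.card_fin, nsmul_eq_mul]
  field_simp

lemma neighborMean_add_smul (φ ψ : Site d → ℝ) (t : ℝ) (x : Site d) :
    neighborMean (φ + t • ψ) x = neighborMean φ x + t * neighborMean ψ x := by
  simp only [neighborMean, Pi.add_apply, Pi.smul_apply, smul_eq_mul, Finset.mul_sum,
    ← Finset.sum_add_distrib]
  exact Finset.sum_congr rfl fun i _ => by ring

lemma neighborMean_neg (φ : Site d → ℝ) (x : Site d) :
    neighborMean (-φ) x = -neighborMean φ x := by
  simp only [neighborMean, Pi.neg_apply, Finset.mul_sum, ← Finset.sum_neg_distrib]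
  exact Finset.sum_congr rfl fun i _ => by ring

lemma neighborMean_congr {φ ψ : Site d → ℝ} {x : Site d}
    (h : ∀ i : Fin d, φ (x + Pi.single i 1) = ψ (x + Pi.single i 1) ∧
      φ (x - Pi.single i 1) = ψ (x - Pi.single i 1)) :
    neighborMean φ x = neighborMean ψ x := by
  simp only [neighborMean, (h _).1, (h _).2]

lemma neighborMean_update_self (φ : Site d → ℝ) (x : Site d) (t : ℝ) :
    neighborMean (Function.update φ x t) x = neighborMean φ x := by
  refine neighborMean_congr fun i => ⟨?_, ?_⟩
  · rw [Function.update_of_ne]; simp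
  · rw [Function.update_of_ne]; simp

@[fun_prop]
lemma measurable_neighborMean (x : Site d) : Measurable fun φ : Site d → ℝ => neighborMean φ x := by
  unfold neighborMean; fun_prop

@[fun_prop]
lemma measurable_hamiltonian (Λ : Finset (Site d)) :
    Measurable fun φ : Site d → ℝ => hamiltonian Λ φ := by
  unfold hamiltonian; fun_prop

lemma hamiltonian_eq_sum [NeZero d] {Λ : Finset (Site d)} {φ : Site d → ℝ}
    (hφ : ∀ x ∉ Λ, φ x = 0) :
    hamiltonian Λ φ = (∑ x ∈ Λ, (φ x - neighborMean φ x) * φ x) / 2 := by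
  rw [hamiltonian_eq_dform, dform_eq_sum hφ]

/-- Enlarging the domain does not change the energy of a configuration supported in the smaller
one. -/
lemma hamiltonian_of_subset [NeZero d] {s Λ : Finset (Site d)} (hs : s ⊆ Λ) {φ : Site d → ℝ}
    (hφ : ∀ x ∉ s, φ x = 0) : hamiltonian Λ φ = hamiltonian s φ := by
  rw [hamiltonian_eq_sum hφ, hamiltonian_eq_sum fun x hx => hφ x fun h => hx (hs h)]
  congr 1
  exact (Finset.sum_subset hs fun x _ hx => by rw [hφ x hx, mul_zero]).symm

lemma neighborMean_single_self (x : Site d) (t : ℝ) :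
    neighborMean (Pi.single x t : Site d → ℝ) x = 0 := by
  have := neighborMean_update_self (0 : Site d → ℝ) x t
  rw [Pi.single, this]
  simp [neighborMean]

/-- Energy of adding height `t` at a fresh site `x`. -/
lemma hamiltonian_insert_update [NeZero d] {s : Finset (Site d)} {x : Site d} (hx : x ∉ s)
    {φ : Site d → ℝ} (hφ : ∀ y ∉ s, φ y = 0) (t : ℝ) :
    hamiltonian (insert x s) (Function.update φ x t) =
      hamiltonian s φ + (t ^ 2 / 2 - t * neighborMean φ x) := by
  have h1 : Function.update φ x t = φ + t • (Pi.single x 1 : Site d → ℝ) := by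
    ext y
    by_cases h : y = x
    · subst h; simp [hφ y hx]
    · simp [h]
  have hsup : ∀ y ∉ insert x s, (Pi.single x 1 : Site d → ℝ) y = 0 := fun y hy =>
    Pi.single_eq_of_ne (fun h : y = x => hy (h.symm ▸ Finset.mem_insert_self _ _)) _
  have hone : ∀ ψ : Site d → ℝ, dform (insert x s) ψ (Pi.single x 1) = ψ x - neighborMean ψ x := by
    intro ψ
    rw [dform_eq_sum hsup, Finset.sum_eq_single x]
    · simp
    · intro y _ hy; simp [hy]
    · simp
  rw [h1, hamiltonian_add_smul, hone, hφ x hx, hamiltonian_eq_dform (insert x s) (Pi.single x 1),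
    hone, neighborMean_single_self, hamiltonian_of_subset (Finset.subset_insert _ _) hφ]
  simp
  ring

/-- A path of `k` edges in direction `i` leaving the domain controls the height at its starting
point by the energy. -/
lemma sq_le_hamiltonian [NeZero d] {Λ : Finset (Site d)} {φ : Site d → ℝ} (hφ : ∀ x ∉ Λ, φ x = 0)
    {x : Site d} {i : Fin d} {k : ℕ} (hk : x + (k : ℤ) • Pi.single i (1 : ℤ) ∉ Λ) :
    (φ x) ^ 2 ≤ 4 * d * k * hamiltonian Λ φ := by
  have hd : (0 : ℝ) < d := Nat.cast_pos.mpr (NeZero.pos d)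
  set u : ℕ → Site d := fun j => x + (j : ℤ) • Pi.single i (1 : ℤ) with hu
  have hu1 : ∀ j, u (j + 1) = u j + Pi.single i 1 := by
    intro j; simp only [hu]; push_cast; rw [add_smul, one_smul, add_assoc]
  have hinj : Function.Injective u := by
    intro j l h
    have := congrFun h i
    simp [hu] at this
    exact_mod_cast this
  have htel : φ x = ∑ j ∈ Finset.range k, (φ (u j) - φ (u (j + 1))) := by
    rw [Finset.sum_range_sub']
    have : φ (u k) = 0 := hφ _ hk
    rw [this, sub_zero]; simp [hu]
  have hcs : (φ x) ^ 2 ≤ k * ∑ j ∈ Finset.range k, (φ (u j) - φ (u (j + 1))) ^ 2 := by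
    rw [htel]
    simpa using sq_sum_le_card_mul_sum_sq (s := Finset.range k)
      (f := fun j => φ (u j) - φ (u (j + 1)))
  have hE : ∑ j ∈ Finset.range k, (φ (u j) - φ (u (j + 1))) ^ 2 ≤
      ∑ y ∈ Λ ∪ Λ.image (fun y => y - Pi.single i (1 : ℤ)), (φ y - φ (y + Pi.single i 1)) ^ 2 := by
    simp only [hu1]
    have himg : ∑ j ∈ Finset.range k, (φ (u j) - φ (u j + Pi.single i 1)) ^ 2 =
        ∑ y ∈ (Finset.range k).image u, (φ y - φ (y + Pi.single i 1)) ^ 2 :=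
      (Finset.sum_image (f := fun y => (φ y - φ (y + Pi.single i 1)) ^ 2)
        fun a _ b _ h => hinj h).symm
    rw [himg, ← Finset.sum_filter_ne_zero]
    refine Finset.sum_le_sum_of_subset_of_nonneg (fun y hy => ?_) fun _ _ _ => sq_nonneg _
    replace hy := (Finset.mem_filter.mp hy).2
    by_contra hc
    simp only [Finset.mem_union, not_or, Finset.mem_image, not_exists, not_and] at hc
    apply hy
    rw [hφ y hc.1, hφ (y + Pi.single i 1) fun h => hc.2 _ h (by simp)]
    simp
  have hH : ∑ y ∈ Λ ∪ Λ.image (fun y => y - Pi.single i (1 : ℤ)),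
      (φ y - φ (y + Pi.single i 1)) ^ 2 ≤ 4 * d * hamiltonian Λ φ := by
    let g : Fin d → ℝ := fun i => ∑ y ∈ Λ ∪ Λ.image (fun y => y - Pi.single i (1 : ℤ)),
      (φ y - φ (y + Pi.single i (1 : ℤ))) ^ 2
    have hg : ∀ j ∈ Finset.univ, 0 ≤ g j := fun j _ => Finset.sum_nonneg fun _ _ => sq_nonneg _
    have h4 : 4 * (d : ℝ) * hamiltonian Λ φ = ∑ i : Fin d, g i := by
      unfold hamiltonian
      rw [← mul_assoc, mul_one_div_cancel (by positivity), one_mul]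
    rw [h4]
    exact Finset.single_le_sum hg (Finset.mem_univ i)
  calc (φ x) ^ 2 ≤ k * (4 * d * hamiltonian Λ φ) := hcs.trans (by gcongr; exact hE.trans hH)
    _ = _ := by ring

lemma exists_exit (Λ : Finset (Site d)) (x : Site d) (i : Fin d) :
    ∃ k : ℕ, x + (k : ℤ) • Pi.single i (1 : ℤ) ∉ Λ := by
  by_contra! h
  have hinj : Function.Injective fun k : ℕ => (⟨_, h k⟩ : Λ) := by
    intro j l hjl
    have := congrFun (Subtype.ext_iff.mp hjl) i
    simp at this
    exact_mod_cast this
  exact not_injective_infinite_finite _ hinj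

/-- The Green function of the domain: it represents evaluation at `x` for the Dirichlet form. -/
lemma exists_green [NeZero d] {Λ : Finset (Site d)} {x : Site d} (hx : x ∈ Λ) :
    ∃ w : Site d → ℝ, (∀ y ∉ Λ, w y = 0) ∧ 0 < w x ∧
      ∀ φ : Site d → ℝ, (∀ y ∉ Λ, φ y = 0) → dform Λ φ w = φ x := by
  let T : (Λ → ℝ) →ₗ[ℝ] (Λ → ℝ) :=
    { toFun := fun φ y => extendZero Λ φ y - neighborMean (extendZero Λ φ) y
      map_add' := by
        intro φ ψ
        ext y
        have : extendZero Λ (φ + ψ) = extendZero Λ φ + (1 : ℝ) • extendZero Λ ψ := by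
          ext z; by_cases hz : z ∈ Λ <;> simp [extendZero, hz]
        rw [this, neighborMean_add_smul]; simp; ring
      map_smul' := by
        intro c φ
        ext y
        have : extendZero Λ (c • φ) = 0 + c • extendZero Λ φ := by
          ext z; by_cases hz : z ∈ Λ <;> simp [extendZero, hz]
        rw [this, neighborMean_add_smul]; simp [neighborMean]; ring }
  have hsupp : ∀ φ : Λ → ℝ, ∀ y ∉ Λ, extendZero Λ φ y = 0 := fun φ y hy => by simp [extendZero, hy]
  have hinj : Function.Injective T := by
    rw [injective_iff_map_eq_zero]
    intro φ hφ
    have h0 : hamiltonian Λ (extendZero Λ φ) = 0 := by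
      rw [hamiltonian_eq_sum (hsupp φ), Finset.sum_eq_zero, zero_div]
      intro y hy
      have : extendZero Λ φ y - neighborMean (extendZero Λ φ) y = 0 := congrFun hφ ⟨y, hy⟩
      rw [this, zero_mul]
    ext y
    obtain ⟨k, hk⟩ := exists_exit Λ y.1 (0 : Fin d)
    have h1 := sq_le_hamiltonian (hsupp φ) hk
    rw [h0, mul_zero] at h1
    have h2 : extendZero Λ φ y.1 = 0 := by nlinarith [sq_nonneg (extendZero Λ φ y.1)]
    simpa [extendZero] using h2
  obtain ⟨w, hw⟩ := (LinearMap.injective_iff_surjective.mp hinj) (Pi.single ⟨x, hx⟩ 1)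
  have hrep : ∀ φ : Site d → ℝ, (∀ y ∉ Λ, φ y = 0) → dform Λ φ (extendZero Λ w) = φ x := by
    intro φ hφ
    rw [dform_comm, dform_eq_sum hφ, Finset.sum_eq_single x]
    · have : extendZero Λ w x - neighborMean (extendZero Λ w) x = 1 := by
        have := congrFun hw ⟨x, hx⟩
        rw [Pi.single_eq_same] at this
        exact this
      rw [this, one_mul]
    · intro y hy hyx
      have : extendZero Λ w y - neighborMean (extendZero Λ w) y = 0 := by
        have := congrFun hw ⟨y, hy⟩
        rw [Pi.single_eq_of_ne (by simpa using hyx)] at this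
        exact this
      rw [this, zero_mul]
    · intro h; exact absurd hx h
  refine ⟨extendZero Λ w, hsupp w, ?_, hrep⟩
  have h1 : hamiltonian Λ (extendZero Λ w) = extendZero Λ w x / 2 := by
    rw [hamiltonian_eq_dform, hrep _ (hsupp w)]
  have h2 : 0 ≤ extendZero Λ w x := by
    have := hamiltonian_nonneg Λ (extendZero Λ w); linarith
  refine lt_of_le_of_ne h2 fun h3 => ?_
  rw [← h3, zero_div] at h1
  have hz : ∀ y, extendZero Λ w y = 0 := by
    intro y
    obtain ⟨k, hk⟩ := exists_exit Λ y (0 : Fin d)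
    have := sq_le_hamiltonian (hsupp w) hk
    rw [h1, mul_zero] at this
    nlinarith [sq_nonneg (extendZero Λ w y)]
  have := congrFun hw ⟨x, hx⟩
  rw [Pi.single_eq_same] at this
  have h4 : extendZero Λ w x - neighborMean (extendZero Λ w) x = 1 := this
  simp [neighborMean, hz] at h4

/-- The harmonic function `u` with value `1` at the fresh site `x` decouples the height at `x` from
the rest: up to a shift of the configuration on `s` by a multiple of `u`, the energy splits. Its
energy `E` is at most `1/2` (compare with the indicator of `x`) and at least `1 / (4dk)` if `x` is `k`
steps away from the complement of the domain. -/
lemma exists_harmonic_shift [NeZero d] {s : Finset (Site d)} {x : Site d} (hx : x ∉ s) :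
    ∃ (τ : Site d → ℝ) (E : ℝ), (∀ y ∉ s, τ y = 0) ∧ 0 < E ∧ E ≤ 1 / 2 ∧
      (∀ (i : Fin d) (k : ℕ), x + (k : ℤ) • Pi.single i (1 : ℤ) ∉ insert x s →
        1 ≤ 4 * d * k * E) ∧
      ∀ (φ : Site d → ℝ), (∀ y ∉ s, φ y = 0) → ∀ t : ℝ,
        hamiltonian (insert x s) (Function.update φ x t) =
          hamiltonian s (φ + t • τ) + t ^ 2 * E := by
  obtain ⟨w, hw0, hwx, hw⟩ := exists_green (Finset.mem_insert_self x s)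
  set u : Site d → ℝ := (w x)⁻¹ • w with hu
  have hux : u x = 1 := by simp [hu, hwx.ne']
  have hu0 : ∀ y ∉ insert x s, u y = 0 := fun y hy => by simp [hu, hw0 y hy]
  set τ : Site d → ℝ := (Pi.single x 1 : Site d → ℝ) - u with hτ
  have hτ0 : ∀ y ∉ s, τ y = 0 := by
    intro y hy
    by_cases h : y = x
    · subst h; simp [hτ, hux]
    · have : y ∉ insert x s := by simp [h, hy]
      simp [hτ, h, hu0 y this]
  have hdu : ∀ φ : Site d → ℝ, (∀ y ∉ s, φ y = 0) → dform (insert x s) φ u = 0 := by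
    intro φ hφ
    have h1 := hw φ (fun y hy => hφ y fun h => hy (Finset.mem_insert_of_mem h))
    rw [hφ x hx] at h1
    have : dform (insert x s) φ u = (w x)⁻¹ * dform (insert x s) φ w := by
      simp only [dform, hu, Pi.smul_apply, smul_eq_mul, Finset.mul_sum]
      refine Finset.sum_congr rfl fun i _ => Finset.sum_congr rfl fun x _ => ?_
      ring
    rw [this, h1, mul_zero]
  have hsplit : ∀ (φ : Site d → ℝ), (∀ y ∉ s, φ y = 0) → ∀ t : ℝ,
        hamiltonian (insert x s) (Function.update φ x t) =
          hamiltonian s (φ + t • τ) + t ^ 2 * hamiltonian (insert x s) u := by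
    intro φ hφ t
    have h1 : Function.update φ x t = (φ + t • τ) + t • u := by
      ext y
      by_cases h : y = x
      · subst h; simp [hφ y hx, hτ, hux]
      · simp [h, hτ]
    have h2 : ∀ y ∉ s, (φ + t • τ) y = 0 := fun y hy => by simp [hφ y hy, hτ0 y hy]
    rw [h1, hamiltonian_add_smul, hdu _ h2,
      hamiltonian_of_subset (Finset.subset_insert _ _) h2]
    ring
  have hlow : ∀ (i : Fin d) (k : ℕ), x + (k : ℤ) • Pi.single i (1 : ℤ) ∉ insert x s →
      1 ≤ 4 * d * k * hamiltonian (insert x s) u := by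
    intro i k hk
    have := sq_le_hamiltonian hu0 hk
    rwa [hux, one_pow] at this
  refine ⟨τ, hamiltonian (insert x s) u, hτ0, ?_, ?_, hlow, hsplit⟩
  · obtain ⟨k, hk⟩ := exists_exit (insert x s) x (0 : Fin d)
    have := hlow _ k hk
    by_contra hneg
    have : hamiltonian (insert x s) u = 0 := le_antisymm (not_lt.mp hneg) (hamiltonian_nonneg _ _)
    simp [this] at *
    linarith
  · have h1 := hsplit 0 (fun _ _ => rfl) 1
    have h2 := hamiltonian_insert_update hx (φ := 0) (fun _ _ => rfl) 1
    have h3 : neighborMean (0 : Site d → ℝ) x = 0 := by simp [neighborMean]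
    have h4 : hamiltonian s (0 : Site d → ℝ) = 0 := by simp [hamiltonian]
    have h5 := hamiltonian_nonneg s ((0 : Site d → ℝ) + (1 : ℝ) • τ)
    rw [h2, h3, h4] at h1
    linarith

/-! ### The unnormalised free field -/


@[fun_prop]
lemma measurable_extendZero (Λ : Finset (Site d)) : Measurable (extendZero Λ) := by
  refine measurable_pi_lambda _ fun x => ?_
  by_cases hx : x ∈ Λ
  · simpa only [extendZero, hx, dite_true] using measurable_pi_apply _
  · simp only [extendZero, hx, dite_false]; exact measurable_const

lemma extendZero_eq_updateFinset (Λ : Finset (Site d)) (φ : Λ → ℝ) :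
    extendZero Λ φ = Function.updateFinset (0 : Site d → ℝ) Λ φ := by
  ext x; by_cases hx : x ∈ Λ <;> simp [extendZero, Function.updateFinset, hx]

/-- Lebesgue measure on the configurations supported in `Λ`, as a measure on all configurations. -/
def flat (Λ : Finset (Site d)) : Measure (Site d → ℝ) :=
  (volume : Measure (Λ → ℝ)).map (extendZero Λ)

lemma lintegral_flat (Λ : Finset (Site d)) {f : (Site d → ℝ) → ℝ≥0∞} (hf : Measurable f) :
    ∫⁻ φ, f φ ∂flat Λ = ∫⁻ φ : Λ → ℝ, f (extendZero Λ φ) :=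
  lintegral_map hf (measurable_extendZero Λ)

lemma lintegral_flat_eq_lmarginal (Λ : Finset (Site d)) {f : (Site d → ℝ) → ℝ≥0∞}
    (hf : Measurable f) : ∫⁻ φ, f φ ∂flat Λ = lmarginal (fun _ => volume) Λ f 0 := by
  simp only [lintegral_flat Λ hf, extendZero_eq_updateFinset]
  rfl

lemma ae_flat (Λ : Finset (Site d)) : ∀ᵐ φ ∂flat Λ, ∀ x ∉ Λ, φ x = 0 := by
  have hm : MeasurableSet {φ : Site d → ℝ | ∀ x ∉ Λ, φ x = 0} := by
    have : {φ : Site d → ℝ | ∀ x ∉ Λ, φ x = 0} = ⋂ x, ⋂ (_ : x ∉ Λ), {φ | φ x = 0} := by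
      ext; simp
    rw [this]
    exact MeasurableSet.iInter fun x => MeasurableSet.iInter fun _ =>
      measurableSet_eq_fun (measurable_pi_apply x) measurable_const
  rw [flat, ae_map_iff (measurable_extendZero Λ).aemeasurable hm]
  exact ae_of_all _ fun φ x hx => by simp [extendZero, hx]

lemma lintegral_flat_insert {s : Finset (Site d)} {x : Site d} (hx : x ∉ s)
    {f : (Site d → ℝ) → ℝ≥0∞} (hf : Measurable f) :
    ∫⁻ φ, f φ ∂flat (insert x s) = ∫⁻ t : ℝ, ∫⁻ φ, f (Function.update φ x t) ∂flat s := by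
  rw [lintegral_flat_eq_lmarginal _ hf, lmarginal_insert f hf hx]
  refine lintegral_congr fun t => ?_
  rw [lmarginal_update_of_notMem hf hx,
    lintegral_flat_eq_lmarginal _ (by fun_prop)]
  rfl

lemma flat_empty : flat (∅ : Finset (Site d)) = Measure.dirac 0 := by
  refine Measure.ext_of_lintegral _ fun f hf => ?_
  rw [lintegral_flat_eq_lmarginal _ hf, lmarginal_empty, lintegral_dirac' _ hf]

lemma lintegral_flat_add {s : Finset (Site d)} {τ : Site d → ℝ} (hτ : ∀ y ∉ s, τ y = 0)
    {f : (Site d → ℝ) → ℝ≥0∞} (hf : Measurable f) :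
    ∫⁻ φ, f (φ + τ) ∂flat s = ∫⁻ φ, f φ ∂flat s := by
  rw [lintegral_flat _ hf, lintegral_flat _ (by fun_prop),
    ← lintegral_add_right_eq_self (fun φ : s → ℝ => f (extendZero s φ)) (fun y : s => τ y)]
  refine lintegral_congr fun φ => congrArg f ?_
  ext y
  by_cases hy : y ∈ s
  · simp [extendZero, hy]
  · simp [extendZero, hy, hτ y hy]

lemma lintegral_flat_neg {s : Finset (Site d)} {f : (Site d → ℝ) → ℝ≥0∞} (hf : Measurable f) :
    ∫⁻ φ, f (-φ) ∂flat s = ∫⁻ φ, f φ ∂flat s := by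
  rw [lintegral_flat _ hf, lintegral_flat _ (by fun_prop)]
  refine Eq.trans ?_ ((Measure.measurePreserving_neg (volume : Measure (s → ℝ))).lintegral_comp
      (hf.comp (measurable_extendZero s)))
  refine lintegral_congr fun φ => congrArg f ?_
  ext y
  by_cases hy : y ∈ s <;> simp [extendZero, hy]

/-- The unnormalised law `exp (-hamiltonian Λ φ) dφ` of the free field on `Λ` with zero boundary
condition, as a measure on configurations on all of `ℤ^d`. -/
def gff (Λ : Finset (Site d)) : Measure (Site d → ℝ) :=
  (flat Λ).withDensity fun φ => ENNReal.ofReal (Real.exp (-hamiltonian Λ φ))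

@[fun_prop]
lemma measurable_weight (Λ : Finset (Site d)) :
    Measurable fun φ : Site d → ℝ => ENNReal.ofReal (Real.exp (-hamiltonian Λ φ)) :=
  ((measurable_hamiltonian Λ).neg.exp).ennreal_ofReal

lemma lintegral_gff (Λ : Finset (Site d)) {f : (Site d → ℝ) → ℝ≥0∞} (hf : Measurable f) :
    ∫⁻ φ, f φ ∂gff Λ = ∫⁻ φ, ENNReal.ofReal (Real.exp (-hamiltonian Λ φ)) * f φ ∂flat Λ := by
  rw [gff, lintegral_withDensity_eq_lintegral_mul _ (measurable_weight Λ) hf]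
  rfl

lemma ae_gff (Λ : Finset (Site d)) : ∀ᵐ φ ∂gff Λ, ∀ x ∉ Λ, φ x = 0 :=
  (withDensity_absolutelyContinuous _ _).ae_le (ae_flat Λ)

lemma gff_empty : gff (∅ : Finset (Site d)) = Measure.dirac 0 := by
  refine Measure.ext_of_lintegral _ fun f hf => ?_
  rw [lintegral_gff _ hf, flat_empty,
    lintegral_dirac' _ (by fun_prop), lintegral_dirac' _ hf]
  simp [hamiltonian]

lemma lintegral_gff_neg {s : Finset (Site d)} {f : (Site d → ℝ) → ℝ≥0∞} (hf : Measurable f) :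
    ∫⁻ φ, f (-φ) ∂gff s = ∫⁻ φ, f φ ∂gff s := by
  rw [lintegral_gff _ hf, lintegral_gff _ (by fun_prop)]
  refine Eq.trans ?_ (lintegral_flat_neg ((measurable_weight s).mul hf))
  simp only [hamiltonian_neg]

/-- Disintegration of the free field at one site: given the rest, the height at `x` is Gaussian
with variance one, centred at the average of its neighbours. -/
lemma lintegral_gff_insert [NeZero d] {s : Finset (Site d)} {x : Site d} (hx : x ∉ s)
    {f : (Site d → ℝ) → ℝ≥0∞} (hf : Measurable f) :
    ∫⁻ φ, f φ ∂gff (insert x s) = ∫⁻ t : ℝ, ∫⁻ φ,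
      ENNReal.ofReal (Real.exp (-(t ^ 2 / 2) + t * neighborMean φ x)) *
        f (Function.update φ x t) ∂gff s := by
  rw [lintegral_gff _ hf, lintegral_flat_insert hx (by fun_prop)]
  refine lintegral_congr fun t => ?_
  have hm : Measurable fun φ : Site d → ℝ =>
      ENNReal.ofReal (Real.exp (-(t ^ 2 / 2) + t * neighborMean φ x)) :=
    (((measurable_neighborMean x).const_mul t).const_add _).exp.ennreal_ofReal
  rw [lintegral_gff _ (by fun_prop)]
  refine lintegral_congr_ae ?_
  filter_upwards [ae_flat s] with φ hφ
  rw [hamiltonian_insert_update hx hφ, ← mul_assoc, ← ENNReal.ofReal_mul (Real.exp_nonneg _),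
    ← Real.exp_add]
  congr 4
  ring

/-- The exponential moments that appear when the height at a fresh site is integrated last. They
say that this height is a centred Gaussian with precision `2E`, where `E` is at least `1 / (4dk)`
if the site is `k` steps away from the complement of the domain. -/
lemma exists_tilt [NeZero d] {s : Finset (Site d)} {x : Site d} (hx : x ∉ s) :
    ∃ E : ℝ, 0 < E ∧ E ≤ 1 / 2 ∧
      (∀ (i : Fin d) (k : ℕ), x + (k : ℤ) • Pi.single i (1 : ℤ) ∉ insert x s →
        1 ≤ 4 * d * k * E) ∧
      ∀ t : ℝ, ∫⁻ φ, ENNReal.ofReal (Real.exp (-(t ^ 2 / 2) + t * neighborMean φ x)) ∂gff s =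
        ENNReal.ofReal (Real.exp (-E * t ^ 2)) * gff s Set.univ := by
  obtain ⟨τ, E, hτ, hE, hE2, hlow, hsplit⟩ := exists_harmonic_shift hx
  refine ⟨E, hE, hE2, hlow, fun t => ?_⟩
  have hm : Measurable fun φ : Site d → ℝ =>
      ENNReal.ofReal (Real.exp (-(t ^ 2 / 2) + t * neighborMean φ x)) :=
    (((measurable_neighborMean x).const_mul t).const_add _).exp.ennreal_ofReal
  have htot : gff s Set.univ =
      ∫⁻ φ, ENNReal.ofReal (Real.exp (-hamiltonian s (φ + t • τ))) ∂flat s := by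
    rw [gff, withDensity_apply _ MeasurableSet.univ, Measure.restrict_univ]
    exact (lintegral_flat_add (τ := t • τ) (fun y hy => by simp [hτ y hy])
      (measurable_weight s)).symm
  have hm2 : Measurable fun φ : Site d → ℝ =>
      ENNReal.ofReal (Real.exp (-hamiltonian s (φ + t • τ))) :=
    (measurable_weight s).comp (measurable_id.add_const (t • τ))
  rw [lintegral_gff _ hm, htot, ← lintegral_const_mul _ hm2]
  refine lintegral_congr_ae ?_
  filter_upwards [ae_flat s] with φ hφ
  rw [← ENNReal.ofReal_mul (Real.exp_nonneg _), ← ENNReal.ofReal_mul (Real.exp_nonneg _),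
    ← Real.exp_add, ← Real.exp_add]
  congr 2
  have h1 := hsplit φ hφ t
  rw [hamiltonian_insert_update hx hφ] at h1
  linarith

/-- The law of the height at `x` in terms of the exponent `E` of `exists_tilt`. -/
lemma lintegral_gff_insert_height [NeZero d] {s : Finset (Site d)} {x : Site d} (hx : x ∉ s) {E : ℝ}
    (hE : ∀ t : ℝ, ∫⁻ φ, ENNReal.ofReal (Real.exp (-(t ^ 2 / 2) + t * neighborMean φ x)) ∂gff s =
        ENNReal.ofReal (Real.exp (-E * t ^ 2)) * gff s Set.univ)
    {f : ℝ → ℝ≥0∞} (hf : Measurable f) :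
    ∫⁻ φ, f (φ x) ∂gff (insert x s) =
      (∫⁻ t, ENNReal.ofReal (Real.exp (-E * t ^ 2)) * f t) * gff s Set.univ := by
  have hfm : Measurable fun φ : Site d → ℝ => f (φ x) := hf.comp (measurable_pi_apply x)
  rw [lintegral_gff_insert hx hfm, ← lintegral_mul_const _ (by fun_prop)]
  refine lintegral_congr fun t => ?_
  simp only [Function.update_self]
  have hm : Measurable fun φ : Site d → ℝ =>
      ENNReal.ofReal (Real.exp (-(t ^ 2 / 2) + t * neighborMean φ x)) :=
    (((measurable_neighborMean x).const_mul t).const_add _).exp.ennreal_ofReal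
  rw [lintegral_mul_const _ hm, hE]
  ring

lemma lintegral_gaussian {E : ℝ} (hE : 0 < E) :
    ∫⁻ t : ℝ, ENNReal.ofReal (Real.exp (-E * t ^ 2)) = ENNReal.ofReal (√(Real.pi / E)) := by
  rw [← ofReal_integral_eq_lintegral_ofReal (integrable_exp_neg_mul_sq hE)
    (ae_of_all _ fun _ => Real.exp_nonneg _), integral_gaussian]

lemma gff_univ_ne [NeZero d] (Λ : Finset (Site d)) :
    gff Λ Set.univ ≠ 0 ∧ gff Λ Set.univ ≠ ∞ := by
  induction Λ using Finset.induction with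
  | empty => simp [gff_empty]
  | insert x s hx ih =>
    obtain ⟨E, hE, -, -, h⟩ := exists_tilt hx
    have := lintegral_gff_insert_height hx h (f := fun _ => 1) measurable_const
    simp only [lintegral_one, mul_one] at this
    rw [this, lintegral_gaussian hE]
    refine ⟨mul_ne_zero ?_ ih.1, ENNReal.mul_ne_top ENNReal.ofReal_ne_top ih.2⟩
    rw [Ne, ENNReal.ofReal_eq_zero, not_le]
    positivity

instance [NeZero d] (Λ : Finset (Site d)) : IsFiniteMeasure (gff Λ) :=
  ⟨(gff_univ_ne Λ).2.lt_top⟩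

instance [NeZero d] (Λ : Finset (Site d)) : NeZero (gff Λ) :=
  ⟨fun h => (gff_univ_ne Λ).1 (by rw [h]; simp)⟩

lemma partitionFunction_eq [NeZero d] (Λ : Finset (Site d)) (a : ℝ) (v : Site d → ℝ) :
    partitionFunction Λ a v = ∫ φ, Real.exp
      (∑ x ∈ Λ, v x * (Set.Icc (-a) a).indicator (fun _ => (1 : ℝ)) (φ x)) ∂gff Λ := by
  have hind : Measurable ((Set.Icc (-a) a).indicator (fun _ => (1 : ℝ))) :=
    measurable_const.indicator measurableSet_Icc
  have hm : Measurable fun φ : Site d → ℝ => Real.exp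
      (∑ x ∈ Λ, v x * (Set.Icc (-a) a).indicator (fun _ => (1 : ℝ)) (φ x)) := by
    refine (Finset.measurable_sum _ fun x _ => ?_).exp
    exact (hind.comp (measurable_pi_apply x)).const_mul _
  rw [integral_eq_lintegral_of_nonneg_ae (ae_of_all _ fun _ => Real.exp_nonneg _)
    hm.aestronglyMeasurable, lintegral_gff _ hm.ennreal_ofReal,
    lintegral_flat _ (by fun_prop), partitionFunction,
    integral_eq_lintegral_of_nonneg_ae (ae_of_all _ fun _ => Real.exp_nonneg _)]
  · congr 1
    refine lintegral_congr fun φ => ?_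
    rw [← ENNReal.ofReal_mul (Real.exp_nonneg _), ← Real.exp_add]
    congr 3
    rw [← Finset.sum_coe_sort Λ]
    refine Finset.sum_congr rfl fun x _ => ?_
    simp [extendZero]
  · refine Measurable.aestronglyMeasurable (Measurable.exp ?_)
    refine ((measurable_hamiltonian Λ).comp (measurable_extendZero Λ)).neg.add
      (Finset.measurable_sum _ fun x _ => ?_)
    exact (hind.comp (measurable_pi_apply x)).const_mul _

/-! ### Partition functions and their logarithmic ratio -/

/-- The indicator function of the well `[-a, a]`. -/
def well (a : ℝ) : ℝ → ℝ := (Set.Icc (-a) a).indicator fun _ => (1 : ℝ)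

@[fun_prop]
lemma measurable_well (a : ℝ) : Measurable (well a) :=
  measurable_const.indicator measurableSet_Icc

lemma well_nonneg (a t : ℝ) : 0 ≤ well a t := Set.indicator_nonneg (fun _ _ => zero_le_one) _

lemma well_le_one (a t : ℝ) : well a t ≤ 1 :=
  Set.indicator_le' (fun _ _ => le_rfl) (fun _ _ => zero_le_one) _

lemma well_neg (a t : ℝ) : well a (-t) = well a t := by
  have : -t ∈ Set.Icc (-a) a ↔ t ∈ Set.Icc (-a) a := by
    simp only [Set.mem_Icc]; constructor <;> rintro ⟨h1, h2⟩ <;> constructor <;> linarith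
  by_cases h : t ∈ Set.Icc (-a) a
  · simp only [well, Set.indicator_of_mem h, Set.indicator_of_mem (this.mpr h)]
  · simp only [well, Set.indicator_of_notMem h, Set.indicator_of_notMem (mt this.mp h)]

lemma well_eq_zero_or_one (a t : ℝ) : well a t = 0 ∨ well a t = 1 := by
  by_cases h : t ∈ Set.Icc (-a) a
  · right; simp [well, Set.indicator_of_mem h]
  · left; simp [well, Set.indicator_of_notMem h]

/-- The total reward collected on `Λ` by a configuration in the potential `v`. -/
def reward (Λ : Finset (Site d)) (a : ℝ) (v φ : Site d → ℝ) : ℝ :=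
  ∑ x ∈ Λ, v x * well a (φ x)

@[fun_prop]
lemma measurable_reward (Λ : Finset (Site d)) (a : ℝ) (v : Site d → ℝ) :
    Measurable (reward Λ a v) :=
  Finset.measurable_sum _ fun x _ => by fun_prop

lemma abs_reward_le (Λ : Finset (Site d)) (a : ℝ) (v φ : Site d → ℝ) :
    |reward Λ a v φ| ≤ ∑ x ∈ Λ, |v x| := by
  refine (Finset.abs_sum_le_sum_abs _ _).trans (Finset.sum_le_sum fun x _ => ?_)
  rw [abs_mul, abs_of_nonneg (well_nonneg _ _)]
  exact mul_le_of_le_one_right (abs_nonneg _) (well_le_one _ _)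

lemma partitionFunction_eq_reward [NeZero d] (Λ : Finset (Site d)) (a : ℝ) (v : Site d → ℝ) :
    partitionFunction Λ a v = ∫ φ, Real.exp (reward Λ a v φ) ∂gff Λ :=
  partitionFunction_eq Λ a v

lemma integrable_exp_of_le [NeZero d] {Λ : Finset (Site d)} {f : (Site d → ℝ) → ℝ}
    (hf : Measurable f) {C : ℝ} (hC : ∀ φ, |f φ| ≤ C) :
    Integrable (fun φ => Real.exp (f φ)) (gff Λ) :=
  Integrable.of_bound hf.exp.aestronglyMeasurable (Real.exp C) (ae_of_all _ fun φ => by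
    rw [Real.norm_eq_abs, abs_of_pos (Real.exp_pos _)]
    exact Real.exp_le_exp.mpr ((le_abs_self _).trans (hC φ)))

lemma integrable_of_le [NeZero d] {Λ : Finset (Site d)} {f : (Site d → ℝ) → ℝ}
    (hf : Measurable f) {C : ℝ} (hC : ∀ φ, |f φ| ≤ C) : Integrable f (gff Λ) :=
  Integrable.of_bound hf.aestronglyMeasurable C (ae_of_all _ hC)

lemma integrable_exp_reward [NeZero d] (Λ : Finset (Site d)) (a : ℝ) (v : Site d → ℝ) :
    Integrable (fun φ => Real.exp (reward Λ a v φ)) (gff Λ) :=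
  integrable_exp_of_le (measurable_reward Λ a v) (abs_reward_le Λ a v)

lemma partitionFunction_pos [NeZero d] (Λ : Finset (Site d)) (a : ℝ) (v : Site d → ℝ) :
    0 < partitionFunction Λ a v := by
  rw [partitionFunction_eq_reward]
  exact integral_exp_pos (integrable_exp_reward Λ a v)

lemma partitionFunction_zero [NeZero d] (Λ : Finset (Site d)) (a : ℝ) :
    partitionFunction Λ a (fun _ => 0) = (gff Λ).real Set.univ := by
  simp [partitionFunction_eq_reward, reward]

lemma ofReal_partitionFunction [NeZero d] (Λ : Finset (Site d)) (a : ℝ) (v : Site d → ℝ) :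
    ENNReal.ofReal (partitionFunction Λ a v) =
      ∫⁻ φ, ENNReal.ofReal (Real.exp (reward Λ a v φ)) ∂gff Λ := by
  rw [partitionFunction_eq_reward, ofReal_integral_eq_lintegral_ofReal
    (integrable_exp_reward Λ a v) (ae_of_all _ fun _ => Real.exp_nonneg _)]

/-- The logarithm of the partition function relative to the free one. -/
def logRatio (Λ : Finset (Site d)) (a : ℝ) (v : Site d → ℝ) : ℝ :=
  Real.log (partitionFunction Λ a v / partitionFunction Λ a (fun _ => 0))

lemma logRatio_eq_sub [NeZero d] (Λ : Finset (Site d)) (a : ℝ) (v : Site d → ℝ) :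
    logRatio Λ a v = Real.log (partitionFunction Λ a v) -
      Real.log (partitionFunction Λ a fun _ => 0) :=
  Real.log_div (partitionFunction_pos _ _ _).ne' (partitionFunction_pos _ _ _).ne'

lemma finiteFreeEnergy_eq (Λ : Finset (Site d)) (a b h : ℝ) (e : Site d → ℝ) :
    finiteFreeEnergy Λ a b h e = (Λ.card : ℝ)⁻¹ * logRatio Λ a fun x => b * e x + h := rfl

lemma logRatio_zero [NeZero d] (Λ : Finset (Site d)) (a : ℝ) :
    logRatio Λ a (fun _ => 0) = 0 := by
  rw [logRatio_eq_sub, sub_self]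

lemma logRatio_le_add [NeZero d] {Λ : Finset (Site d)} {a : ℝ} {v w : Site d → ℝ} {C : ℝ}
    (h : ∀ φ, reward Λ a v φ ≤ reward Λ a w φ + C) : logRatio Λ a v ≤ logRatio Λ a w + C := by
  have hC : partitionFunction Λ a v ≤ partitionFunction Λ a w * Real.exp C := by
    rw [partitionFunction_eq_reward, partitionFunction_eq_reward, ← integral_mul_const]
    refine integral_mono (integrable_exp_reward Λ a v)
      ((integrable_exp_reward Λ a w).mul_const _) fun φ => ?_
    simp only
    rw [← Real.exp_add]
    exact Real.exp_le_exp.mpr (h φ)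
  have := Real.log_le_log (partitionFunction_pos Λ a v) hC
  rw [Real.log_mul (partitionFunction_pos Λ a w).ne' (Real.exp_pos _).ne', Real.log_exp] at this
  rw [logRatio_eq_sub, logRatio_eq_sub]
  linarith

lemma logRatio_mono [NeZero d] {Λ : Finset (Site d)} {a : ℝ} {v w : Site d → ℝ}
    (h : ∀ x ∈ Λ, v x ≤ w x) : logRatio Λ a v ≤ logRatio Λ a w := by
  have := logRatio_le_add (Λ := Λ) (a := a) (v := v) (w := w) (C := 0) fun φ => by
    rw [add_zero]
    exact Finset.sum_le_sum fun x hx => mul_le_mul_of_nonneg_right (h x hx) (well_nonneg _ _)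
  linarith

lemma logRatio_le_add_sum [NeZero d] (Λ : Finset (Site d)) (a : ℝ) (v w : Site d → ℝ) :
    logRatio Λ a v ≤ logRatio Λ a w + ∑ x ∈ Λ, |v x - w x| := by
  refine logRatio_le_add fun φ => ?_
  rw [reward, reward, ← Finset.sum_add_distrib]
  refine Finset.sum_le_sum fun x _ => ?_
  have h1 := well_nonneg a (φ x)
  have h2 := well_le_one a (φ x)
  nlinarith [le_abs_self (v x - w x), abs_nonneg (v x - w x)]

lemma abs_logRatio_sub_le [NeZero d] (Λ : Finset (Site d)) (a : ℝ) (v w : Site d → ℝ) :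
    |logRatio Λ a v - logRatio Λ a w| ≤ ∑ x ∈ Λ, |v x - w x| := by
  have h1 := logRatio_le_add_sum Λ a v w
  have h2 := logRatio_le_add_sum Λ a w v
  simp only [abs_sub_comm (w _)] at h2
  rw [abs_le]
  constructor <;> linarith

lemma abs_logRatio_le [NeZero d] (Λ : Finset (Site d)) (a : ℝ) (v : Site d → ℝ) :
    |logRatio Λ a v| ≤ ∑ x ∈ Λ, |v x| := by
  simpa [logRatio_zero] using abs_logRatio_sub_le Λ a v fun _ => 0

lemma logRatio_congr {Λ : Finset (Site d)} {a : ℝ} {v w : Site d → ℝ}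
    (h : ∀ x ∈ Λ, v x = w x) : logRatio Λ a v = logRatio Λ a w := by
  have : partitionFunction Λ a v = partitionFunction Λ a w := by
    unfold partitionFunction
    congr 1; ext φ; congr 2
    exact Finset.sum_congr rfl fun x _ => by rw [h x x.2]
  rw [logRatio, this, logRatio]

lemma reward_neg (Λ : Finset (Site d)) (a : ℝ) (v φ : Site d → ℝ) :
    reward Λ a v (-φ) = reward Λ a v φ := by
  simp [reward, well_neg]

lemma reward_insert_update {s : Finset (Site d)} {x : Site d} (hx : x ∉ s) (a : ℝ)
    (v φ : Site d → ℝ) (t : ℝ) :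
    reward (insert x s) a v (Function.update φ x t) = v x * well a t + reward s a v φ := by
  rw [reward, Finset.sum_insert hx, Function.update_self, reward]
  congr 1
  refine Finset.sum_congr rfl fun y hy => ?_
  rw [Function.update_of_ne]
  rintro rfl
  exact hx hy

/-- Under a symmetric law, an odd tilt does not decrease an exponential moment once the exponent is
symmetrised. -/
lemma lintegral_exp_symm_le [NeZero d] {s : Finset (Site d)} {ℓ S : (Site d → ℝ) → ℝ}
    (hℓ : Measurable ℓ) (hodd : ∀ φ, ℓ (-φ) = -ℓ φ) (hS : Measurable S) :
    ∫⁻ φ, ENNReal.ofReal (Real.exp ((S φ + S (-φ)) / 2)) ∂gff s ≤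
      ∫⁻ φ, ENNReal.ofReal (Real.exp (ℓ φ + S φ)) ∂gff s := by
  have hm : Measurable fun φ => ENNReal.ofReal (Real.exp (ℓ φ + S φ)) := by fun_prop
  have h1 : ∫⁻ φ, ENNReal.ofReal (Real.exp (-ℓ φ + S (-φ))) ∂gff s =
      ∫⁻ φ, ENNReal.ofReal (Real.exp (ℓ φ + S φ)) ∂gff s := by
    rw [← lintegral_gff_neg hm]
    simp only [hodd]
  have h2 : 2 * ∫⁻ φ, ENNReal.ofReal (Real.exp ((S φ + S (-φ)) / 2)) ∂gff s ≤
      2 * ∫⁻ φ, ENNReal.ofReal (Real.exp (ℓ φ + S φ)) ∂gff s := by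
    rw [two_mul (∫⁻ φ, ENNReal.ofReal (Real.exp (ℓ φ + S φ)) ∂gff s)]
    nth_rewrite 2 [← h1]
    rw [← lintegral_add_left hm, ← lintegral_const_mul _ (by fun_prop)]
    refine lintegral_mono fun φ => ?_
    rw [← ENNReal.ofReal_add (Real.exp_nonneg _) (Real.exp_nonneg _), ← ENNReal.ofReal_ofNat 2,
      ← ENNReal.ofReal_mul (by norm_num)]
    refine ENNReal.ofReal_le_ofReal ?_
    have h3 := Real.one_le_cosh (ℓ φ + (S φ - S (-φ)) / 2)
    rw [Real.cosh_eq] at h3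
    have h4 : ℓ φ + S φ = (S φ + S (-φ)) / 2 + (ℓ φ + (S φ - S (-φ)) / 2) := by ring
    have h5 : -ℓ φ + S (-φ) = (S φ + S (-φ)) / 2 + -(ℓ φ + (S φ - S (-φ)) / 2) := by ring
    rw [h4, h5, Real.exp_add, Real.exp_add _ (-_), ← mul_add, mul_comm]
    exact mul_le_mul_of_nonneg_left (by linarith) (Real.exp_nonneg _)
  exact (ENNReal.mul_le_mul_iff_right (by simp) (by simp)).mp h2

/-- Freeing the height at one more site changes the pinned partition function at least by a
constant factor. -/
lemma partitionFunction_insert_ge [NeZero d] {s : Finset (Site d)} {x : Site d} (hx : x ∉ s)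
    (a : ℝ) (v : Site d → ℝ) :
    Real.exp (-|v x|) * √(2 * Real.pi) * partitionFunction s a v ≤
      partitionFunction (insert x s) a v := by
  have hnn := (partitionFunction_pos s a v).le
  rw [← ENNReal.ofReal_le_ofReal_iff (partitionFunction_pos _ a v).le,
    ENNReal.ofReal_mul (by positivity), ofReal_partitionFunction (insert x s),
    lintegral_gff_insert hx (by fun_prop)]
  have hg := lintegral_gaussian (E := 1 / 2) (by norm_num)
  have h2 : Real.pi / (1 / 2) = 2 * Real.pi := by ring
  rw [h2] at hg
  rw [ENNReal.ofReal_mul (Real.exp_nonneg _), ← hg, ← lintegral_const_mul _ (by fun_prop),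
    ← lintegral_mul_const _ (by fun_prop)]
  refine lintegral_mono fun t => ?_
  have h3 : ENNReal.ofReal (partitionFunction s a v) ≤
      ∫⁻ φ, ENNReal.ofReal (Real.exp (t * neighborMean φ x + reward s a v φ)) ∂gff s := by
    rw [ofReal_partitionFunction]
    have := lintegral_exp_symm_le (s := s) ((measurable_neighborMean x).const_mul t)
      (fun φ => by rw [neighborMean_neg]; ring) (measurable_reward s a v)
    simpa only [reward_neg, add_self_div_two] using this
  refine (mul_le_mul_right h3 _).trans ?_
  rw [← lintegral_const_mul _ (by fun_prop)]
  refine lintegral_mono fun φ => ?_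
  simp only
  rw [reward_insert_update hx]
  simp only [← ENNReal.ofReal_mul (Real.exp_nonneg _), ← Real.exp_add]
  refine ENNReal.ofReal_le_ofReal (Real.exp_le_exp.mpr ?_)
  have h1 := well_nonneg a t
  have h2 := well_le_one a t
  nlinarith [neg_abs_le (v x), abs_nonneg (v x)]

/-- The law of the height at a site of the free field. -/
lemma exists_height_law [NeZero d] {Λ : Finset (Site d)} {x : Site d} (hx : x ∈ Λ) :
    ∃ E : ℝ, 0 < E ∧ E ≤ 1 / 2 ∧
      (∀ (i : Fin d) (k : ℕ), x + (k : ℤ) • Pi.single i (1 : ℤ) ∉ Λ → 1 ≤ 4 * d * k * E) ∧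
      (gff Λ).real Set.univ = √(Real.pi / E) * (gff (Λ.erase x)).real Set.univ ∧
      ∀ A : Set ℝ, MeasurableSet A → (gff Λ).real {φ | φ x ∈ A} =
        (∫ t in A, Real.exp (-E * t ^ 2)) * (gff (Λ.erase x)).real Set.univ := by
  obtain ⟨E, hE, hE2, hlow, h⟩ := exists_tilt (Finset.notMem_erase x Λ)
  rw [Finset.insert_erase hx] at hlow
  have key : ∀ A : Set ℝ, MeasurableSet A → (gff Λ).real {φ | φ x ∈ A} =
      (∫ t in A, Real.exp (-E * t ^ 2)) * (gff (Λ.erase x)).real Set.univ := by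
    intro A hA
    have h1 := lintegral_gff_insert_height (Finset.notMem_erase x Λ) h
      (f := A.indicator 1) (measurable_one.indicator hA)
    rw [Finset.insert_erase hx] at h1
    have h2 : ∫⁻ φ, A.indicator (1 : ℝ → ℝ≥0∞) (φ x) ∂gff Λ = gff Λ {φ | φ x ∈ A} := by
      have hA' : MeasurableSet {φ : Site d → ℝ | φ x ∈ A} := measurable_pi_apply x hA
      rw [← lintegral_indicator_one hA']
      rfl
    have h3 : ∫⁻ t, ENNReal.ofReal (Real.exp (-E * t ^ 2)) * A.indicator 1 t =
        ENNReal.ofReal (∫ t in A, Real.exp (-E * t ^ 2)) := by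
      rw [ofReal_integral_eq_lintegral_ofReal (integrable_exp_neg_mul_sq hE).integrableOn
        (ae_of_all _ fun _ => Real.exp_nonneg _), ← lintegral_indicator hA]
      refine lintegral_congr fun t => ?_
      by_cases ht : t ∈ A <;> simp [ht]
    rw [h2, h3] at h1
    rw [Measure.real, h1, ENNReal.toReal_mul, ENNReal.toReal_ofReal
      (integral_nonneg fun _ => Real.exp_nonneg _), Measure.real]
  refine ⟨E, hE, hE2, hlow, ?_, key⟩
  have := key Set.univ MeasurableSet.univ
  rw [setIntegral_univ, integral_gaussian] at this
  simpa using this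

lemma gff_real_univ_pos [NeZero d] (Λ : Finset (Site d)) : 0 < (gff Λ).real Set.univ :=
  ENNReal.toReal_pos (gff_univ_ne Λ).1 (gff_univ_ne Λ).2

/-- Removing a site next to the complement of the domain costs at most a constant. -/
lemma logRatio_erase_le [NeZero d] {Λ : Finset (Site d)} {x : Site d} (hx : x ∈ Λ) {i : Fin d}
    (hi : x + Pi.single i (1 : ℤ) ∉ Λ) (a : ℝ) (v : Site d → ℝ) :
    logRatio (Λ.erase x) a v - (|v x| + Real.log (2 * d)) ≤ logRatio Λ a v := by
  have hd : (1 : ℝ) ≤ d := by exact_mod_cast NeZero.one_le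
  obtain ⟨E, hE, -, hlow, hZ, -⟩ := exists_height_law hx
  have hE4 := hlow i 1 (by simpa using hi)
  have h1 := partitionFunction_insert_ge (Finset.notMem_erase x Λ) a v
  rw [Finset.insert_erase hx] at h1
  have h0 : partitionFunction Λ a (fun _ => 0) ≤
      √(2 * Real.pi) * (2 * d) * partitionFunction (Λ.erase x) a (fun _ => 0) := by
    rw [partitionFunction_zero, partitionFunction_zero, hZ]
    refine mul_le_mul_of_nonneg_right ?_ measureReal_nonneg
    have : √(2 * Real.pi) * (2 * d) = √(2 * Real.pi * (2 * d) ^ 2) := by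
      rw [Real.sqrt_mul (x := 2 * Real.pi) (by positivity), Real.sqrt_sq (by positivity)]
    rw [this]
    refine Real.sqrt_le_sqrt ?_
    rw [div_le_iff₀ hE]
    simp only [Nat.cast_one, mul_one] at hE4
    nlinarith [Real.pi_pos, mul_le_mul_of_nonneg_left hE4 Real.pi_pos.le,
      mul_nonneg (mul_nonneg Real.pi_pos.le hE.le) (sub_nonneg.mpr hd)]
  have l1 := Real.log_le_log (by have := partitionFunction_pos (Λ.erase x) a v; positivity) h1
  have l0 := Real.log_le_log (partitionFunction_pos Λ a fun _ => 0) h0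
  have p1 := (partitionFunction_pos (Λ.erase x) a v).ne'
  have p0 := (partitionFunction_pos (Λ.erase x) a fun _ => 0).ne'
  have hs : √(2 * Real.pi) ≠ 0 := by positivity
  rw [Real.log_mul (by positivity) p1, Real.log_mul (Real.exp_pos _).ne' hs, Real.log_exp] at l1
  rw [Real.log_mul (by positivity) p0, Real.log_mul hs (by positivity)] at l0
  rw [logRatio_eq_sub, logRatio_eq_sub]
  linarith

/-- Removing a family of walls, each site of which is next to another wall site or to the
complement of the domain, costs at most a constant per site: the sites are removed in decreasing
order of their coordinate sum. -/
lemma logRatio_sdiff_le [NeZero d] (W : Finset (Site d)) {Λ : Finset (Site d)} (hW : W ⊆ Λ)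
    (hadj : ∀ x ∈ W, ∃ i : Fin d, x + Pi.single i (1 : ℤ) ∉ Λ \ W) {a V : ℝ} {v : Site d → ℝ}
    (hv : ∀ x, |v x| ≤ V) :
    logRatio (Λ \ W) a v - (V + Real.log (2 * d)) * W.card ≤ logRatio Λ a v := by
  induction hn : W.card generalizing W Λ with
  | zero => rw [Finset.card_eq_zero] at hn; subst hn; simp
  | succ n ih =>
    have hne : W.Nonempty := by rw [← Finset.card_pos, hn]; omega
    obtain ⟨x, hxW, hmax⟩ := W.exists_max_image (fun y => ∑ j, y j) hne
    obtain ⟨i, hi⟩ := hadj x hxW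
    have hnW : x + Pi.single i (1 : ℤ) ∉ W := by
      intro h
      have := hmax _ h
      simp [Finset.sum_add_distrib] at this
    have hnΛ : x + Pi.single i (1 : ℤ) ∉ Λ := fun h => hi (Finset.mem_sdiff.mpr ⟨h, hnW⟩)
    have heq : Λ.erase x \ W.erase x = Λ \ W := by
      ext y; simp only [Finset.mem_sdiff, Finset.mem_erase]
      constructor
      · rintro ⟨⟨h1, h2⟩, h3⟩; exact ⟨h2, fun h => h3 ⟨h1, h⟩⟩
      · rintro ⟨h1, h2⟩
        exact ⟨⟨fun h => h2 (h ▸ hxW), h1⟩, fun h => h2 h.2⟩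
    have h1 := ih (W.erase x) (Λ := Λ.erase x) (Finset.erase_subset_erase _ hW)
      (fun y hy => by rw [heq]; exact hadj y (Finset.mem_of_mem_erase hy))
      (by rw [Finset.card_erase_of_mem hxW, hn]; rfl)
    have h2 := logRatio_erase_le (hW hxW) hnΛ a v
    rw [heq] at h1
    have h3 := hv x
    push_cast
    linarith

/-! ### Independence of separated domains and translation covariance -/

lemma lintegral_gff_union [NeZero d] {s t : Finset (Site d)} (hst : Disjoint s t)
    (hadj : ∀ x ∈ s, ∀ i : Fin d, x + Pi.single i (1 : ℤ) ∉ t ∧ x - Pi.single i (1 : ℤ) ∉ t)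
    {f g : (Site d → ℝ) → ℝ≥0∞} (hf : Measurable f) (hg : Measurable g)
    (hft : ∀ φ ψ : Site d → ℝ, (∀ y ∉ t, φ y = ψ y) → f φ = f ψ)
    (hgs : ∀ φ ψ : Site d → ℝ, (∀ y ∉ s, φ y = ψ y) → g φ = g ψ)
    (hgt : ∫⁻ φ, g φ ∂gff t ≠ ∞) :
    ∫⁻ φ, f φ * g φ ∂gff (s ∪ t) = (∫⁻ φ, f φ ∂gff s) * ∫⁻ φ, g φ ∂gff t := by
  induction s using Finset.induction generalizing f g with
  | empty =>
    rw [gff_empty, lintegral_dirac' _ hf, Finset.empty_union, ← lintegral_const_mul _ hg]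
    refine lintegral_congr_ae ?_
    filter_upwards [ae_gff t] with φ hφ
    rw [hft φ 0 hφ]
  | insert x s hx ih =>
    rw [Finset.disjoint_insert_left] at hst
    have hxu : x ∉ s ∪ t := by simp [hx, hst.1]
    rw [Finset.insert_union, lintegral_gff_insert hxu (by fun_prop), lintegral_gff_insert hx hf,
      ← lintegral_mul_const' _ _ hgt]
    refine lintegral_congr fun r => ?_
    have h1 : ∀ φ, g (Function.update φ x r) = g φ := fun φ => hgs _ _ fun y hy => by
      rw [Function.update_of_ne]
      rintro rfl
      exact hy (Finset.mem_insert_self _ _)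
    simp only [h1, ← mul_assoc]
    refine ih hst.2 (fun y hy => hadj y (Finset.mem_insert_of_mem hy)) (by fun_prop) hg ?_
      (fun φ ψ h => hgs φ ψ fun y hy => h y fun h' => hy (Finset.mem_insert_of_mem h')) hgt
    intro φ ψ h
    have h2 := hadj x (Finset.mem_insert_self _ _)
    rw [neighborMean_congr fun i => ⟨h _ (h2 i).1, h _ (h2 i).2⟩, hft (Function.update φ x r)]
    intro y hy
    by_cases hyx : y = x
    · simp [hyx]
    · simp [hyx, h y hy]

lemma reward_congr {Λ : Finset (Site d)} {a : ℝ} {v φ ψ : Site d → ℝ}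
    (h : ∀ y ∈ Λ, φ y = ψ y) : reward Λ a v φ = reward Λ a v ψ :=
  Finset.sum_congr rfl fun y hy => by rw [h y hy]

lemma partitionFunction_union [NeZero d] {s t : Finset (Site d)} (hst : Disjoint s t)
    (hadj : ∀ x ∈ s, ∀ i : Fin d, x + Pi.single i (1 : ℤ) ∉ t ∧ x - Pi.single i (1 : ℤ) ∉ t)
    (a : ℝ) (v : Site d → ℝ) :
    partitionFunction (s ∪ t) a v = partitionFunction s a v * partitionFunction t a v := by
  rw [← ENNReal.ofReal_eq_ofReal_iff (partitionFunction_pos _ _ _).le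
    (mul_nonneg (partitionFunction_pos _ _ _).le (partitionFunction_pos _ _ _).le),
    ENNReal.ofReal_mul (partitionFunction_pos _ _ _).le]
  simp only [ofReal_partitionFunction]
  rw [← lintegral_gff_union hst hadj (by fun_prop) (by fun_prop)]
  · refine lintegral_congr fun φ => ?_
    rw [← ENNReal.ofReal_mul (Real.exp_nonneg _), ← Real.exp_add, reward, Finset.sum_union hst]
    rfl
  · intro φ ψ h
    rw [reward_congr fun y hy => h y (Finset.disjoint_left.mp hst hy)]
  · intro φ ψ h
    rw [reward_congr fun y hy => h y (Finset.disjoint_right.mp hst hy)]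
  · rw [← ofReal_partitionFunction]; exact ENNReal.ofReal_ne_top

lemma logRatio_union [NeZero d] {s t : Finset (Site d)} (hst : Disjoint s t)
    (hadj : ∀ x ∈ s, ∀ i : Fin d, x + Pi.single i (1 : ℤ) ∉ t ∧ x - Pi.single i (1 : ℤ) ∉ t)
    (a : ℝ) (v : Site d → ℝ) :
    logRatio (s ∪ t) a v = logRatio s a v + logRatio t a v := by
  simp only [logRatio_eq_sub, partitionFunction_union hst hadj,
    Real.log_mul (partitionFunction_pos _ _ _).ne' (partitionFunction_pos _ _ _).ne']
  ring

lemma logRatio_empty [NeZero d] (a : ℝ) (v : Site d → ℝ) : logRatio ∅ a v = 0 := by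
  rw [logRatio_congr (w := fun _ => 0) (by simp), logRatio_zero]

lemma logRatio_biUnion [NeZero d] {ι : Type*} [DecidableEq ι] (J : Finset ι)
    {B : ι → Finset (Site d)} (hB : ∀ j ∈ J, ∀ k ∈ J, j ≠ k → Disjoint (B j) (B k) ∧
      ∀ x ∈ B j, ∀ i : Fin d, x + Pi.single i (1 : ℤ) ∉ B k ∧ x - Pi.single i (1 : ℤ) ∉ B k)
    (a : ℝ) (v : Site d → ℝ) :
    logRatio (J.biUnion B) a v = ∑ j ∈ J, logRatio (B j) a v := by
  induction J using Finset.induction with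
  | empty => simp [logRatio_empty]
  | insert j J hj ih =>
    have hne : ∀ k ∈ J, j ≠ k := fun k hk h => hj (h ▸ hk)
    have hsep := fun k hk => hB j (Finset.mem_insert_self _ _) k (Finset.mem_insert_of_mem hk)
      (hne k hk)
    rw [Finset.biUnion_insert, Finset.sum_insert hj, logRatio_union, ih]
    · exact fun j hj k hk => hB j (Finset.mem_insert_of_mem hj) k (Finset.mem_insert_of_mem hk)
    · rw [Finset.disjoint_biUnion_right]
      exact fun k hk => (hsep k hk).1
    · intro x hx i
      simp only [Finset.mem_biUnion, not_exists, not_and]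
      exact ⟨fun k hk => ((hsep k hk).2 x hx i).1, fun k hk => ((hsep k hk).2 x hx i).2⟩

lemma lintegral_gff_image [NeZero d] (Λ : Finset (Site d)) (z : Site d)
    {f : (Site d → ℝ) → ℝ≥0∞} (hf : Measurable f) :
    ∫⁻ φ, f φ ∂gff (Λ.image (· + z)) = ∫⁻ φ, f (fun x => φ (x - z)) ∂gff Λ := by
  induction Λ using Finset.induction generalizing f with
  | empty => simp [gff_empty, lintegral_dirac' _ hf]; rfl
  | insert x s hx ih =>
    have hxz : x + z ∉ s.image (· + z) := by simpa using hx
    rw [Finset.image_insert, lintegral_gff_insert hxz hf,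
      lintegral_gff_insert hx (by fun_prop)]
    refine lintegral_congr fun t => ?_
    rw [ih (by fun_prop)]
    refine lintegral_congr fun φ => ?_
    have h1 : neighborMean (fun y => φ (y - z)) (x + z) = neighborMean φ x := by
      simp only [neighborMean]
      congr 1
      refine Finset.sum_congr rfl fun i _ => ?_
      congr 2 <;> abel
    have h2 : Function.update (fun y => φ (y - z)) (x + z) t =
        fun y => Function.update φ x t (y - z) := by
      ext y
      by_cases h : y = x + z
      · simp [h]
      · rw [Function.update_of_ne h, Function.update_of_ne]
        exact fun h' => h (sub_eq_iff_eq_add.mp h')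
    rw [h1, h2]

lemma logRatio_image [NeZero d] (Λ : Finset (Site d)) (z : Site d) (a : ℝ) (v : Site d → ℝ) :
    logRatio (Λ.image (· + z)) a v = logRatio Λ a fun x => v (x + z) := by
  have key : ∀ w : Site d → ℝ, partitionFunction (Λ.image (· + z)) a w =
      partitionFunction Λ a fun x => w (x + z) := by
    intro w
    rw [← ENNReal.ofReal_eq_ofReal_iff (partitionFunction_pos _ _ _).le
      (partitionFunction_pos _ _ _).le, ofReal_partitionFunction, ofReal_partitionFunction,
      lintegral_gff_image _ _ (by fun_prop)]
    refine lintegral_congr fun φ => ?_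
    rw [reward, Finset.sum_image fun x _ y _ h => add_right_cancel h]
    simp [reward]
  rw [logRatio, logRatio, key, key]

/-! ### Jensen's inequality and entropic repulsion -/

lemma average_le_log [NeZero d] {Λ : Finset (Site d)} {f : (Site d → ℝ) → ℝ} (hf : Measurable f)
    {C : ℝ} (hC : ∀ φ, |f φ| ≤ C) :
    ⨍ φ, f φ ∂gff Λ ≤ Real.log ((∫ φ, Real.exp (f φ) ∂gff Λ) / (gff Λ).real Set.univ) := by
  have hi := integrable_exp_of_le (Λ := Λ) hf hC
  have h := convexOn_exp.map_average_le (μ := gff Λ) (f := f) Real.continuous_exp.continuousOn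
    isClosed_univ (ae_of_all _ fun _ => Set.mem_univ _) (integrable_of_le hf hC) hi
  rw [average_eq _ fun φ => Real.exp (f φ), smul_eq_mul, inv_mul_eq_div] at h
  exact (Real.le_log_iff_exp_le (div_pos (integral_exp_pos hi) (gff_real_univ_pos Λ))).mpr h

/-- The probability that the free field shifted by `s` at the site `x` lies in the well. -/
def occupation (Λ : Finset (Site d)) (a s : ℝ) (x : Site d) : ℝ :=
  ⨍ φ, well a (φ x + s) ∂gff Λ

lemma occupation_eq [NeZero d] {Λ : Finset (Site d)} (a s : ℝ) (x : Site d) :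
    occupation Λ a s x =
      (gff Λ).real {φ | φ x ∈ Set.Icc (-a - s) (a - s)} / (gff Λ).real Set.univ := by
  have hm : MeasurableSet {φ : Site d → ℝ | φ x ∈ Set.Icc (-a - s) (a - s)} :=
    measurable_pi_apply x measurableSet_Icc
  rw [occupation, average_eq, smul_eq_mul, inv_mul_eq_div]
  congr 1
  rw [← integral_indicator_one hm]
  refine integral_congr_ae (ae_of_all _ fun φ => ?_)
  change well a (φ x + s) = _
  have : φ x + s ∈ Set.Icc (-a) a ↔ φ x ∈ Set.Icc (-a - s) (a - s) := by
    simp only [Set.mem_Icc]; constructor <;> rintro ⟨h1, h2⟩ <;> constructor <;> linarith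
  by_cases h : φ x + s ∈ Set.Icc (-a) a
  · have h' : φ ∈ {φ : Site d → ℝ | φ x ∈ Set.Icc (-a - s) (a - s)} := this.mp h
    rw [Set.indicator_of_mem h', well, Set.indicator_of_mem h, Pi.one_apply]
  · have h' : φ ∉ {φ : Site d → ℝ | φ x ∈ Set.Icc (-a - s) (a - s)} := fun h' => h (this.mpr h')
    rw [Set.indicator_of_notMem h', well, Set.indicator_of_notMem h]

/-- A site at distance `k` from the complement of the domain is in the well with probability at
least of order `k ^ (-1/2)`. -/
lemma occupation_ge [NeZero d] {Λ : Finset (Site d)} {x : Site d} (hx : x ∈ Λ) {i : Fin d} {k : ℕ}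
    (hk : x + (k : ℤ) • Pi.single i (1 : ℤ) ∉ Λ) {a : ℝ} (ha : 0 < a) :
    2 * a * Real.exp (-a ^ 2 / 2) / √(4 * Real.pi * d * k) ≤ occupation Λ a 0 x := by
  obtain ⟨E, hE, hE2, hlow, hZ, hA⟩ := exists_height_law hx
  have hk0 := hlow i k hk
  have hpos := gff_real_univ_pos (Λ.erase x)
  rw [occupation_eq, hA _ measurableSet_Icc, hZ, mul_div_mul_right _ _ hpos.ne', sub_zero, sub_zero]
  have hI : 2 * a * Real.exp (-a ^ 2 / 2) ≤ ∫ t in Set.Icc (-a) a, Real.exp (-E * t ^ 2) := by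
    have h1 : ∫ _ in Set.Icc (-a) a, Real.exp (-a ^ 2 / 2) = 2 * a * Real.exp (-a ^ 2 / 2) := by
      rw [setIntegral_const, Measure.real, Real.volume_Icc, ENNReal.toReal_ofReal (by linarith)]
      simp; ring_nf
    rw [← h1]
    refine setIntegral_mono_on (by simp) (integrable_exp_neg_mul_sq hE).integrableOn
      measurableSet_Icc fun t ht => Real.exp_le_exp.mpr ?_
    have h2 : t ^ 2 ≤ a ^ 2 := sq_le_sq' ht.1 ht.2
    nlinarith [sq_nonneg t]
  refine div_le_div₀ ((by positivity : (0 : ℝ) ≤ 2 * a * Real.exp (-a ^ 2 / 2)).trans hI) hI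
    (by positivity) (Real.sqrt_le_sqrt ?_)
  rw [div_le_iff₀ hE]
  nlinarith [Real.pi_pos]

/-- The density of a centred Gaussian at distance `y` from its mean is at most `1 / y`, whatever its
variance; so far from the origin the shifted field rarely visits the well. -/
lemma occupation_le [NeZero d] {Λ : Finset (Site d)} {x : Site d} (hx : x ∈ Λ) {a s : ℝ}
    (ha : 0 < a) (hs : a < |s|) : occupation Λ a s x ≤ 2 * a / (|s| - a) := by
  obtain ⟨E, hE, -, -, hZ, hA⟩ := exists_height_law hx
  have hpos := gff_real_univ_pos (Λ.erase x)
  have hy : 0 < |s| - a := by linarith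
  set y := |s| - a with hydef
  rw [occupation_eq, hA _ measurableSet_Icc, hZ, mul_div_mul_right _ _ hpos.ne']
  have hI : ∫ t in Set.Icc (-a - s) (a - s), Real.exp (-E * t ^ 2) ≤
      2 * a * Real.exp (-E * y ^ 2) := by
    have h1 : ∫ _ in Set.Icc (-a - s) (a - s), Real.exp (-E * y ^ 2) =
        2 * a * Real.exp (-E * y ^ 2) := by
      rw [setIntegral_const, Measure.real, Real.volume_Icc, ENNReal.toReal_ofReal (by linarith)]
      rw [smul_eq_mul]; ring
    rw [← h1]
    refine setIntegral_mono_on (integrable_exp_neg_mul_sq hE).integrableOn (by simp)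
      measurableSet_Icc fun t ht => Real.exp_le_exp.mpr ?_
    have h2 : y ≤ |t| := by
      rcases abs_cases s with ⟨h, _⟩ | ⟨h, _⟩ <;> rcases abs_cases t with ⟨h', _⟩ | ⟨h', _⟩ <;>
        linarith [ht.1, ht.2]
    have h3 : y ^ 2 ≤ t ^ 2 := by rw [← sq_abs t]; gcongr
    nlinarith
  rw [div_le_iff₀ (by positivity)]
  refine hI.trans ?_
  rw [div_mul_eq_mul_div, mul_div_assoc]
  refine mul_le_mul_of_nonneg_left ?_ (by positivity)
  rw [le_div_iff₀ hy]
  have h4 : Real.exp (-E * y ^ 2) ≤ (1 + E * y ^ 2)⁻¹ := by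
    rw [neg_mul, Real.exp_neg]
    exact inv_anti₀ (by positivity) (by linarith [Real.add_one_le_exp (E * y ^ 2)])
  have h5 : √(1 / E) ≤ √(Real.pi / E) :=
    Real.sqrt_le_sqrt (div_le_div_of_nonneg_right (by linarith [Real.pi_gt_three]) hE.le)
  refine le_trans ?_ h5
  refine Real.le_sqrt_of_sq_le ?_
  rw [mul_pow, le_div_iff₀ hE]
  have h6 : Real.exp (-E * y ^ 2) ^ 2 ≤ (1 + E * y ^ 2)⁻¹ * 1 := by
    rw [sq]
    exact mul_le_mul h4 (Real.exp_le_one_iff.mpr (by nlinarith [sq_nonneg y])) (Real.exp_nonneg _)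
      (by positivity)
  calc Real.exp (-E * y ^ 2) ^ 2 * y ^ 2 * E ≤ (1 + E * y ^ 2)⁻¹ * 1 * y ^ 2 * E := by gcongr
    _ = E * y ^ 2 / (1 + E * y ^ 2) := by field_simp
    _ ≤ 1 := by rw [div_le_one (by positivity)]; linarith

lemma integrable_well [NeZero d] (Λ : Finset (Site d)) (a s : ℝ) (x : Site d) :
    Integrable (fun φ => well a (φ x + s)) (gff Λ) :=
  integrable_of_le (by fun_prop) (C := 1) fun φ => by
    rw [abs_of_nonneg (well_nonneg _ _)]; exact well_le_one _ _

/-- Lower bound by raising the field to height `M` inside the domain. -/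
lemma logRatio_ge_of_shift [NeZero d] {Λ : Finset (Site d)} {a M V : ℝ} (ha : 0 < a) (hM : a < M)
    (hV : 0 ≤ V) {v : Site d → ℝ} (hv : ∀ x, |v x| ≤ V) :
    -(M ^ 2 * hamiltonian Λ fun x => if x ∈ Λ then 1 else 0) - V * Λ.card * (2 * a / (M - a)) ≤
      logRatio Λ a v := by
  set u : Site d → ℝ := fun x => if x ∈ Λ then 1 else 0 with hu
  have hu0 : ∀ y ∉ Λ, u y = 0 := fun y hy => by simp [hu, hy]
  set S : (Site d → ℝ) → ℝ := fun φ => reward Λ a v (φ + M • u) with hS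
  have hSm : Measurable S := (measurable_reward Λ a v).comp (measurable_id.add_const (M • u))
  have hdm : Measurable fun φ : Site d → ℝ => -(M * dform Λ φ u) := by
    unfold dform; fun_prop
  have hSb : ∀ φ, |(S φ + S (-φ)) / 2| ≤ ∑ x ∈ Λ, |v x| := by
    intro φ
    have h1 := abs_le.mp (abs_reward_le Λ a v (φ + M • u))
    have h2 := abs_le.mp (abs_reward_le Λ a v (-φ + M • u))
    simp only [hS, abs_le]
    constructor <;> linarith [h1.1, h1.2, h2.1, h2.2]
  have hS2 : Measurable fun φ => (S φ + S (-φ)) / 2 := by fun_prop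
  have hshift : ENNReal.ofReal (partitionFunction Λ a v) =
      ENNReal.ofReal (Real.exp (-(M ^ 2 * hamiltonian Λ u))) *
        ∫⁻ φ, ENNReal.ofReal (Real.exp (-(M * dform Λ φ u) + S φ)) ∂gff Λ := by
    have hm1 : Measurable fun φ : Site d → ℝ => ENNReal.ofReal (Real.exp (-hamiltonian Λ φ)) *
        ENNReal.ofReal (Real.exp (reward Λ a v φ)) := by fun_prop
    have hm2 : Measurable fun φ : Site d → ℝ =>
      ENNReal.ofReal (Real.exp (-(M * dform Λ φ u) + S φ)) := by fun_prop
    rw [ofReal_partitionFunction, lintegral_gff _ (by fun_prop), lintegral_gff _ hm2,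
      ← lintegral_flat_add (τ := M • u) (fun y hy => by simp [hu0 y hy]) hm1,
      ← lintegral_const_mul _ (by fun_prop)]
    refine lintegral_congr fun φ => ?_
    simp only [← ENNReal.ofReal_mul (Real.exp_nonneg _), ← Real.exp_add]
    rw [hamiltonian_add_smul]
    congr 2
    simp only [hS]
    ring
  have h1 : Real.exp (-(M ^ 2 * hamiltonian Λ u)) * (∫ φ, Real.exp ((S φ + S (-φ)) / 2) ∂gff Λ) ≤
      partitionFunction Λ a v := by
    rw [← ENNReal.ofReal_le_ofReal_iff (partitionFunction_pos _ _ _).le, hshift,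
      ENNReal.ofReal_mul (Real.exp_nonneg _), ofReal_integral_eq_lintegral_ofReal
      (integrable_exp_of_le hS2 hSb) (ae_of_all _ fun _ => Real.exp_nonneg _)]
    refine mul_le_mul_right ?_ _
    refine lintegral_exp_symm_le hdm (fun φ => ?_) hSm
    have : dform Λ (-φ) u = - dform Λ φ u := by
      simp only [dform, Pi.neg_apply, Finset.mul_sum, ← Finset.sum_neg_distrib]
      exact Finset.sum_congr rfl fun i _ => Finset.sum_congr rfl fun x _ => by ring
    rw [this]; ring
  have h2 := average_le_log (Λ := Λ) hS2 hSb
  have hip := integral_exp_pos (integrable_exp_of_le (Λ := Λ) hS2 hSb)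
  have h3 := Real.log_le_log (mul_pos (Real.exp_pos _) hip) h1
  rw [Real.log_mul (Real.exp_pos _).ne' hip.ne', Real.log_exp] at h3
  rw [Real.log_div hip.ne' (gff_real_univ_pos Λ).ne'] at h2
  rw [logRatio_eq_sub, partitionFunction_zero]
  have h4 : -(V * Λ.card * (2 * a / (M - a))) ≤ ⨍ φ, (S φ + S (-φ)) / 2 ∂gff Λ := by
    have h5 : ∀ φ ∈ (Set.univ : Set (Site d → ℝ)),
        -V * ∑ x ∈ Λ, (well a (φ x + M) + well a (φ x + -M)) / 2 ≤ (S φ + S (-φ)) / 2 := by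
      intro φ _
      simp only [hS, reward, ← Finset.sum_add_distrib, Finset.sum_div, Finset.mul_sum]
      refine Finset.sum_le_sum fun x hx => ?_
      have h6 : (-φ + M • u) x = -(φ x + -M) := by simp [hu, hx, add_comm]
      have h7 : (φ + M • u) x = φ x + M := by simp [hu, hx]
      rw [h6, h7, well_neg]
      have := (abs_le.mp (hv x)).1
      nlinarith [well_nonneg a (φ x + M), well_nonneg a (φ x + -M)]
    have hi : ∀ x ∈ Λ, Integrable (fun φ => (well a (φ x + M) + well a (φ x + -M)) / 2) (gff Λ) :=
      fun x _ => ((integrable_well Λ a M x).add (integrable_well Λ a (-M) x)).div_const 2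
    have h8 : ⨍ φ, -V * ∑ x ∈ Λ, (well a (φ x + M) + well a (φ x + -M)) / 2 ∂gff Λ =
        -V * ∑ x ∈ Λ, (occupation Λ a M x + occupation Λ a (-M) x) / 2 := by
      rw [average_eq, integral_const_mul, integral_finsetSum _ hi, smul_eq_mul, mul_left_comm,
        Finset.mul_sum]
      congr 1
      refine Finset.sum_congr rfl fun x _ => ?_
      rw [integral_div, integral_add (integrable_well Λ a M x) (integrable_well Λ a (-M) x),
        occupation, occupation, average_eq, average_eq, smul_eq_mul, smul_eq_mul]
      ring
    have h9 : ⨍ φ, -V * ∑ x ∈ Λ, (well a (φ x + M) + well a (φ x + -M)) / 2 ∂gff Λ ≤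
        ⨍ φ, (S φ + S (-φ)) / 2 ∂gff Λ := by
      rw [average_eq, average_eq]
      refine smul_le_smul_of_nonneg_left (integral_mono ?_ (integrable_of_le hS2 hSb)
        fun φ => h5 φ trivial) (by positivity)
      exact (integrable_finsetSum _ hi).const_mul _
    rw [h8] at h9
    refine le_trans ?_ h9
    have h10 : ∑ x ∈ Λ, (occupation Λ a M x + occupation Λ a (-M) x) / 2 ≤
        ∑ _x ∈ Λ, 2 * a / (M - a) := by
      refine Finset.sum_le_sum fun x hx => ?_
      have hMp : |M| = M := abs_of_pos (by linarith)
      have h11 := occupation_le hx ha (s := M) (by rwa [hMp])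
      have h12 := occupation_le hx ha (s := -M) (by rwa [abs_neg, hMp])
      rw [abs_neg, hMp] at h12
      rw [hMp] at h11
      linarith
    rw [Finset.sum_const, nsmul_eq_mul] at h10
    nlinarith
  linarith

/-! ### Resampling a sublattice -/

/-- The probability that a Gaussian with mean `m` and variance one lies in the well. -/
def hitProb (a m : ℝ) : ℝ := ∫ t, well a t ∂gaussianReal m 1

/-- An upper bound for `hitProb a m` that is uniform in `m` and strictly less than one. -/
def maxHit (a : ℝ) : ℝ := 1 - (gaussianReal 0 1).real (Set.Ioi a)

lemma integrable_well_gaussian (a m : ℝ) : Integrable (well a) (gaussianReal m 1) :=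
  Integrable.of_bound (by fun_prop) 1 (ae_of_all _ fun t => by
    rw [Real.norm_eq_abs, abs_of_nonneg (well_nonneg _ _)]; exact well_le_one _ _)

lemma hitProb_nonneg (a m : ℝ) : 0 ≤ hitProb a m := integral_nonneg fun _ => well_nonneg _ _

lemma hitProb_eq (a m : ℝ) : hitProb a m = (gaussianReal m 1).real (Set.Icc (-a) a) :=
  integral_indicator_one measurableSet_Icc

lemma hitProb_eq_integral (a m : ℝ) : hitProb a m = ∫ t, well a (t + m) ∂gaussianReal 0 1 := by
  have h := gaussianReal_map_add_const (μ := 0) (v := 1) m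
  rw [zero_add] at h
  rw [hitProb, ← h, integral_map (by fun_prop) (by fun_prop)]

@[fun_prop]
lemma measurable_hitProb (a : ℝ) : Measurable (hitProb a) := by
  have h1 : hitProb a = fun m => ∫ t, well a (t + m) ∂gaussianReal 0 1 :=
    funext (hitProb_eq_integral a)
  rw [h1]
  have h2 : Measurable fun p : ℝ × ℝ => well a (p.2 + p.1) := by fun_prop
  exact (h2.stronglyMeasurable.integral_prod_right (ν := gaussianReal 0 1)).measurable

lemma hitProb_neg (a m : ℝ) : hitProb a (-m) = hitProb a m := by
  have h := gaussianReal_map_neg (μ := m) (v := 1)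
  rw [hitProb, ← h, integral_map (by fun_prop) (by fun_prop)]
  simp only [well_neg, hitProb]

lemma hitProb_le (a m : ℝ) : hitProb a m ≤ maxHit a := by
  have key : ∀ m : ℝ, 0 ≤ m → hitProb a m ≤ maxHit a := by
    intro m hm
    have h1 : (gaussianReal 0 1).real (Set.Ioi a) ≤ (gaussianReal m 1).real (Set.Ioi a) := by
      have h := gaussianReal_map_add_const (μ := 0) (v := 1) m
      rw [zero_add] at h
      rw [← h, map_measureReal_apply (by fun_prop) measurableSet_Ioi]
      refine measureReal_mono fun t ht => ?_
      simp only [Set.mem_preimage, Set.mem_Ioi] at ht ⊢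
      linarith
    have h2 : (gaussianReal m 1).real (Set.Icc (-a) a) + (gaussianReal m 1).real (Set.Ioi a) ≤
        1 := by
      have hdis : Disjoint (Set.Icc (-a) a) (Set.Ioi a) :=
        Set.disjoint_left.mpr fun t ht ht' => not_lt.mpr ht.2 ht'
      rw [← measureReal_union hdis measurableSet_Ioi]
      exact measureReal_le_one
    rw [hitProb_eq, maxHit]
    linarith
  rcases le_total 0 m with hm | hm
  · exact key m hm
  · rw [← hitProb_neg]; exact key _ (by linarith)

lemma maxHit_lt_one (a : ℝ) : maxHit a < 1 := by
  have h : 0 < (gaussianReal 0 1).real (Set.Ioi a) := by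
    refine ENNReal.toReal_pos (fun h => ?_) (measure_ne_top _ _)
    have := (gaussianReal_absolutelyContinuous' 0 one_ne_zero) h
    simp at this
  rw [maxHit]; linarith

lemma hitProb_zero_pos {a : ℝ} (ha : 0 < a) : 0 < hitProb a 0 := by
  rw [hitProb_eq]
  refine ENNReal.toReal_pos (fun h => ?_) (measure_ne_top _ _)
  have := (gaussianReal_absolutelyContinuous' 0 one_ne_zero) h
  rw [Real.volume_Icc, ENNReal.ofReal_eq_zero] at this
  linarith

lemma maxHit_pos {a : ℝ} (ha : 0 < a) : 0 < maxHit a :=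
  (hitProb_zero_pos ha).trans_le (hitProb_le a 0)

lemma lintegral_exp_well (a v m : ℝ) :
    ∫⁻ t, ENNReal.ofReal (Real.exp (v * well a t)) ∂gaussianReal m 1 =
      ENNReal.ofReal (1 + (Real.exp v - 1) * hitProb a m) := by
  have h1 : ∀ t, Real.exp (v * well a t) = 1 + (Real.exp v - 1) * well a t := by
    intro t
    rcases well_eq_zero_or_one a t with h | h <;> simp [h]
  have hi : Integrable (fun t => 1 + (Real.exp v - 1) * well a t) (gaussianReal m 1) :=
    (integrable_const _).add ((integrable_well_gaussian a m).const_mul _)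
  rw [lintegral_congr fun t => by rw [h1 t], ← ofReal_integral_eq_lintegral_ofReal hi
    (ae_of_all _ fun t => (Real.exp_nonneg _).trans_eq (h1 t)), integral_add
    (integrable_const _) ((integrable_well_gaussian a m).const_mul _), integral_const_mul]
  simp [hitProb]

/-- Given the rest of the field, the height at a site is Gaussian with variance one around the mean
of its neighbours, so it can be integrated out. -/
lemma lintegral_gff_resample [NeZero d] {Λ : Finset (Site d)} {x : Site d} (hx : x ∈ Λ)
    {F : ℝ → ℝ≥0∞} (hF : Measurable F) {G : (Site d → ℝ) → ℝ≥0∞} (hG : Measurable G)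
    (hGx : ∀ φ t, G (Function.update φ x t) = G φ) {K : ℝ → ℝ≥0∞} (hK : Measurable K)
    (hFK : ∀ m, ∫⁻ t, F t ∂gaussianReal m 1 = K m) :
    ∫⁻ φ, F (φ x) * G φ ∂gff Λ = ∫⁻ φ, K (neighborMean φ x) * G φ ∂gff Λ := by
  have hgauss : ∀ (F' : ℝ → ℝ≥0∞), Measurable F' → ∀ m : ℝ,
      ∫⁻ t : ℝ, ENNReal.ofReal (Real.exp (-(t ^ 2 / 2) + t * m)) * F' t =
        ENNReal.ofReal (√(2 * Real.pi) * Real.exp (m ^ 2 / 2)) *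
          ∫⁻ t, F' t ∂gaussianReal m 1 := by
    intro F' hF' m
    rw [gaussianReal_of_var_ne_zero m one_ne_zero,
      lintegral_withDensity_eq_lintegral_mul _ (measurable_gaussianPDF m 1) hF',
      ← lintegral_const_mul _ ((measurable_gaussianPDF m 1).mul hF')]
    refine lintegral_congr fun t => ?_
    rw [Pi.mul_apply, ← mul_assoc, gaussianPDF, ← ENNReal.ofReal_mul (by positivity),
      gaussianPDFReal]
    congr 2
    have h0 : √(2 * Real.pi) ≠ 0 := by positivity
    simp only [NNReal.coe_one, mul_one]
    rw [mul_mul_mul_comm, mul_inv_cancel₀ h0, one_mul, ← Real.exp_add]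
    congr 1; ring
  have key : ∀ (F' : ℝ → ℝ≥0∞), Measurable F' → ∀ (G' : (Site d → ℝ) → ℝ≥0∞), Measurable G' →
      (∀ φ t, G' (Function.update φ x t) = G' φ) →
      ∫⁻ φ, F' (φ x) * G' φ ∂gff Λ = ∫⁻ φ, G' φ *
        (ENNReal.ofReal (√(2 * Real.pi) * Real.exp ((neighborMean φ x) ^ 2 / 2)) *
          ∫⁻ t, F' t ∂gaussianReal (neighborMean φ x) 1) ∂gff (Λ.erase x) := by
    intro F' hF' G' hG' hGx'
    have h1 := lintegral_gff_insert (Finset.notMem_erase x Λ) (f := fun φ => F' (φ x) * G' φ)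
      (by fun_prop)
    rw [Finset.insert_erase hx] at h1
    rw [h1, lintegral_lintegral_swap]
    · refine lintegral_congr fun φ => ?_
      simp only [hGx', Function.update_self]
      rw [← hgauss F' hF', ← lintegral_const_mul _ (by fun_prop)]
      refine lintegral_congr fun t => ?_
      ring
    · simp only [hGx', Function.update_self]
      have : Measurable fun p : ℝ × (Site d → ℝ) =>
          ENNReal.ofReal (Real.exp (-(p.1 ^ 2 / 2) + p.1 * neighborMean p.2 x)) *
            (F' p.1 * G' p.2) := by fun_prop
      exact this.aemeasurable
  have hKG : Measurable fun φ : Site d → ℝ => K (neighborMean φ x) * G φ := by fun_prop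
  have h1 := key F hF G hG hGx
  have h2 := key (fun _ => 1) measurable_const _ hKG fun φ t => by
    rw [neighborMean_update_self, hGx]
  simp only [one_mul, lintegral_one, measure_univ, mul_one] at h2
  rw [h1, h2]
  refine lintegral_congr fun φ => ?_
  rw [hFK]
  ring

/-- The exponent left after integrating out the heights at the sites of `T`, no two of which are
adjacent: the logarithms of the conditional averages of `exp (v x * well a (φ x))` for `x ∈ T`,
plus the reward on the other sites. -/
def resampledReward (Λ T : Finset (Site d)) (a : ℝ) (v φ : Site d → ℝ) : ℝ :=
  ∑ x ∈ T, Real.log (1 + (Real.exp (v x) - 1) * hitProb a (neighborMean φ x)) +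
    reward (Λ \ T) a v φ

@[fun_prop]
lemma measurable_resampledReward (Λ T : Finset (Site d)) (a : ℝ) (v : Site d → ℝ) :
    Measurable (resampledReward Λ T a v) := by
  unfold resampledReward
  refine Measurable.add (Finset.measurable_sum _ fun x _ => ?_) (by fun_prop)
  fun_prop

lemma hitProb_le_one (a m : ℝ) : hitProb a m ≤ 1 := (hitProb_le a m).trans (maxHit_lt_one a).le

lemma one_add_mul_pos {p α : ℝ} (hp0 : 0 ≤ p) (hp : p < 1) (hα : -1 < α) : 0 < 1 + α * p := by
  nlinarith

lemma abs_log_tilt_le {v p : ℝ} (hp0 : 0 ≤ p) (hp : p ≤ 1) :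
    |Real.log (1 + (Real.exp v - 1) * p)| ≤ |v| := by
  have h1 : 1 + (Real.exp v - 1) * p = (1 - p) * 1 + p * Real.exp v := by ring
  have h0 := Real.exp_pos v
  have hlow : Real.exp (-|v|) ≤ 1 + (Real.exp v - 1) * p := by
    have h2 : Real.exp (-|v|) ≤ 1 := Real.exp_le_one_iff.mpr (by simp)
    have h3 : Real.exp (-|v|) ≤ Real.exp v := Real.exp_le_exp.mpr (neg_abs_le v)
    nlinarith
  have hup : 1 + (Real.exp v - 1) * p ≤ Real.exp |v| := by
    have h2 : 1 ≤ Real.exp |v| := Real.one_le_exp (abs_nonneg v)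
    have h3 : Real.exp v ≤ Real.exp |v| := Real.exp_le_exp.mpr (le_abs_self v)
    nlinarith
  have hpos := (Real.exp_pos _).trans_le hlow
  rw [abs_le]
  exact ⟨(Real.le_log_iff_exp_le hpos).mpr hlow, (Real.log_le_iff_le_exp hpos).mpr hup⟩

lemma abs_resampledReward_le (Λ T : Finset (Site d)) (a : ℝ) (v φ : Site d → ℝ) :
    |resampledReward Λ T a v φ| ≤ ∑ x ∈ T, |v x| + ∑ x ∈ Λ \ T, |v x| := by
  refine (abs_add_le _ _).trans (add_le_add ?_ (abs_reward_le _ _ _ _))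
  refine (Finset.abs_sum_le_sum_abs _ _).trans (Finset.sum_le_sum fun x _ => ?_)
  exact abs_log_tilt_le (hitProb_nonneg _ _) (hitProb_le_one _ _)

/-- Sites of `T` are integrated out one at a time: no other conditional average depends on the
height at such a site, since no neighbour of it lies in `T`. -/
lemma lintegral_exp_resampledReward [NeZero d] {Λ T : Finset (Site d)} (hT : T ⊆ Λ)
    (hind : ∀ x ∈ T, ∀ i : Fin d, x + Pi.single i (1 : ℤ) ∉ T ∧ x - Pi.single i (1 : ℤ) ∉ T)
    (a : ℝ) (v : Site d → ℝ) :
    ∫⁻ φ, ENNReal.ofReal (Real.exp (resampledReward Λ T a v φ)) ∂gff Λ =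
      ENNReal.ofReal (partitionFunction Λ a v) := by
  induction T using Finset.induction with
  | empty => rw [ofReal_partitionFunction]; simp [resampledReward]
  | insert x T hx ih =>
    have hxΛ : x ∈ Λ := hT (Finset.mem_insert_self _ _)
    rw [← ih ((Finset.subset_insert _ _).trans hT) fun y hy i =>
      ⟨fun h => (hind y (Finset.mem_insert_of_mem hy) i).1 (Finset.mem_insert_of_mem h),
        fun h => (hind y (Finset.mem_insert_of_mem hy) i).2 (Finset.mem_insert_of_mem h)⟩]
    set G : (Site d → ℝ) → ℝ := fun φ =>
      ∑ y ∈ T, Real.log (1 + (Real.exp (v y) - 1) * hitProb a (neighborMean φ y)) +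
        reward (Λ \ insert x T) a v φ with hG
    have hGm : Measurable G := by
      refine Measurable.add (Finset.measurable_sum _ fun x _ => ?_) (by fun_prop)
      fun_prop
    have hGx : ∀ φ t, G (Function.update φ x t) = G φ := by
      intro φ t
      simp only [hG]
      congr 1
      · refine Finset.sum_congr rfl fun y hy => ?_
        rw [neighborMean_congr (ψ := φ) fun i => ⟨?_, ?_⟩]
        · rw [Function.update_of_ne]
          rintro h
          exact (hind y (Finset.mem_insert_of_mem hy) i).1 (h ▸ Finset.mem_insert_self _ _)
        · rw [Function.update_of_ne]
          rintro h
          exact (hind y (Finset.mem_insert_of_mem hy) i).2 (h ▸ Finset.mem_insert_self _ _)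
      · refine reward_congr fun y hy => ?_
        rw [Function.update_of_ne]
        rintro rfl
        simp at hy
    have h1 : ∀ φ, ENNReal.ofReal (Real.exp (resampledReward Λ T a v φ)) =
        ENNReal.ofReal (Real.exp (v x * well a (φ x))) * ENNReal.ofReal (Real.exp (G φ)) := by
      intro φ
      rw [← ENNReal.ofReal_mul (Real.exp_nonneg _), ← Real.exp_add]
      have hsd : Λ \ T = insert x (Λ \ insert x T) := by
        ext y; simp only [Finset.mem_sdiff, Finset.mem_insert, not_or]
        constructor
        · rintro ⟨h1, h2⟩
          by_cases h : y = x
          · exact Or.inl h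
          · exact Or.inr ⟨h1, h, h2⟩
        · rintro (rfl | ⟨h1, -, h2⟩)
          · exact ⟨hxΛ, hx⟩
          · exact ⟨h1, h2⟩
      rw [resampledReward, hsd, reward, Finset.sum_insert (by simp), hG]
      congr 2
      simp only [reward]
      ring
    have h2 : ∀ φ, ENNReal.ofReal (Real.exp (resampledReward Λ (insert x T) a v φ)) =
        ENNReal.ofReal (1 + (Real.exp (v x) - 1) * hitProb a (neighborMean φ x)) *
          ENNReal.ofReal (Real.exp (G φ)) := by
      intro φ
      have hpos : 0 < 1 + (Real.exp (v x) - 1) * hitProb a (neighborMean φ x) :=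
        one_add_mul_pos (hitProb_nonneg _ _) ((hitProb_le _ _).trans_lt (maxHit_lt_one a))
          (by linarith [Real.exp_pos (v x)])
      rw [← ENNReal.ofReal_mul hpos.le, resampledReward, Finset.sum_insert hx, add_assoc,
        Real.exp_add, Real.exp_log hpos]
    simp only [h1, h2]
    exact (lintegral_gff_resample hxΛ (F := fun t => ENNReal.ofReal (Real.exp (v x * well a t)))
      (by fun_prop) (by fun_prop) (fun φ t => by rw [hGx])
      (K := fun m => ENNReal.ofReal (1 + (Real.exp (v x) - 1) * hitProb a m)) (by fun_prop)
      fun m => lintegral_exp_well a (v x) m).symm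

lemma average_hitProb [NeZero d] {Λ : Finset (Site d)} {x : Site d} (hx : x ∈ Λ) (a : ℝ) :
    ⨍ φ, hitProb a (neighborMean φ x) ∂gff Λ = occupation Λ a 0 x := by
  have h := lintegral_gff_resample hx (F := fun t => ENNReal.ofReal (well a t)) (by fun_prop)
    (G := fun _ => 1) measurable_const (fun _ _ => rfl)
    (K := fun m => ENNReal.ofReal (hitProb a m)) (by fun_prop) fun m => by
      rw [hitProb, ofReal_integral_eq_lintegral_ofReal (integrable_well_gaussian a m)
        (ae_of_all _ fun _ => well_nonneg _ _)]
  simp only [mul_one] at h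
  rw [occupation, average_eq, average_eq]
  congr 1
  rw [integral_eq_lintegral_of_nonneg_ae (ae_of_all _ fun _ => hitProb_nonneg _ _)
    (Measurable.aestronglyMeasurable (by fun_prop)),
    integral_eq_lintegral_of_nonneg_ae (ae_of_all _ fun _ => well_nonneg _ _)
    (Measurable.aestronglyMeasurable (by fun_prop))]
  simp only [add_zero, h]

/-- The averaged contribution of one resampled site in the potential `v`. -/
def siteGain (Λ : Finset (Site d)) (a : ℝ) (x : Site d) (v : ℝ) : ℝ :=
  ⨍ φ, Real.log (1 + (Real.exp v - 1) * hitProb a (neighborMean φ x)) ∂gff Λ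

lemma integrable_siteGain [NeZero d] (Λ : Finset (Site d)) (a : ℝ) (x : Site d) (v : ℝ) :
    Integrable (fun φ => Real.log (1 + (Real.exp v - 1) * hitProb a (neighborMean φ x)))
      (gff Λ) :=
  integrable_of_le (by fun_prop) fun _ =>
    abs_log_tilt_le (hitProb_nonneg _ _) (hitProb_le_one _ _)

/-- Jensen's inequality after resampling. -/
lemma logRatio_ge_resampled [NeZero d] {Λ T : Finset (Site d)} (hT : T ⊆ Λ)
    (hind : ∀ x ∈ T, ∀ i : Fin d, x + Pi.single i (1 : ℤ) ∉ T ∧ x - Pi.single i (1 : ℤ) ∉ T)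
    (a : ℝ) (v : Site d → ℝ) :
    ∑ x ∈ T, siteGain Λ a x (v x) + ∑ x ∈ Λ \ T, v x * occupation Λ a 0 x ≤ logRatio Λ a v := by
  have hm := measurable_resampledReward Λ T a v
  have hb := abs_resampledReward_le Λ T a v
  have h1 := average_le_log (Λ := Λ) hm hb
  have h2 : ∫ φ, Real.exp (resampledReward Λ T a v φ) ∂gff Λ = partitionFunction Λ a v := by
    rw [← ENNReal.ofReal_eq_ofReal_iff (integral_nonneg fun _ => Real.exp_nonneg _)
      (partitionFunction_pos _ _ _).le, ofReal_integral_eq_lintegral_ofReal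
      (integrable_exp_of_le hm hb) (ae_of_all _ fun _ => Real.exp_nonneg _)]
    exact lintegral_exp_resampledReward hT hind a v
  rw [h2, ← partitionFunction_zero Λ a] at h1
  refine le_trans (le_of_eq ?_) h1
  have hi1 : ∀ x ∈ T, Integrable (fun φ =>
      Real.log (1 + (Real.exp (v x) - 1) * hitProb a (neighborMean φ x))) (gff Λ) :=
    fun x _ => integrable_siteGain Λ a x (v x)
  have hi2 : ∀ x ∈ Λ \ T, Integrable (fun φ => v x * well a (φ x)) (gff Λ) := fun x _ => by
    simpa using (integrable_well Λ a 0 x).const_mul (v x)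
  simp only [resampledReward, reward]
  rw [average_eq, integral_add (integrable_finsetSum _ hi1) (integrable_finsetSum _ hi2),
    integral_finsetSum _ hi1, integral_finsetSum _ hi2, smul_add, Finset.smul_sum,
    Finset.smul_sum]
  congr 1
  · exact Finset.sum_congr rfl fun x _ => by rw [siteGain, average_eq]
  · refine Finset.sum_congr rfl fun x _ => ?_
    rw [occupation, average_eq, integral_const_mul]
    simp only [add_zero, smul_eq_mul]
    ring

/-! ### The gain from the disorder -/

/-- The gain per visit of a resampled site, averaged over the two signs of the environment. -/
def meanGain (a b h : ℝ) : ℝ :=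
  (Real.log (1 + (Real.exp (b + h) - 1) * maxHit a) +
    Real.log (1 + (Real.exp (-b + h) - 1) * maxHit a)) / (2 * maxHit a)

lemma log_tilt_concave {α p q : ℝ} (hα : -1 < α) (hp : 0 ≤ p) (hpq : p ≤ q) (hq : 0 < q)
    (hq1 : q < 1) : p / q * Real.log (1 + α * q) ≤ Real.log (1 + α * p) := by
  have h := strictConcaveOn_log_Ioi.concaveOn.2
    (Set.mem_Ioi.mpr (one_add_mul_pos hq.le hq1 hα)) (Set.mem_Ioi.mpr one_pos)
    (div_nonneg hp hq.le) (sub_nonneg.mpr ((div_le_one hq).mpr hpq)) (add_sub_cancel _ _)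
  simp only [smul_eq_mul, Real.log_one, mul_zero, add_zero] at h
  refine h.trans (le_of_eq ?_)
  congr 1
  field_simp
  ring

lemma siteGain_add_ge [NeZero d] {Λ : Finset (Site d)} {x : Site d} (hx : x ∈ Λ) {a : ℝ}
    (ha : 0 < a) (b h : ℝ) :
    meanGain a b h * occupation Λ a 0 x ≤
      (siteGain Λ a x (b + h) + siteGain Λ a x (-b + h)) / 2 := by
  have hq := maxHit_pos ha
  have hi : Integrable (fun φ => hitProb a (neighborMean φ x)) (gff Λ) :=
    integrable_of_le (by fun_prop) (C := 1) fun φ => by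
      rw [abs_of_nonneg (hitProb_nonneg _ _)]; exact hitProb_le_one _ _
  have hi1 := integrable_siteGain Λ a x (b + h)
  have hi2 := integrable_siteGain Λ a x (-b + h)
  rw [← average_hitProb hx, siteGain, siteGain, average_eq, average_eq, average_eq, ← smul_add,
    ← integral_add hi1 hi2, smul_eq_mul, smul_eq_mul, mul_left_comm, ← integral_const_mul,
    mul_div_assoc, ← integral_div]
  refine mul_le_mul_of_nonneg_left (integral_mono (hi.const_mul _) ((hi1.add hi2).div_const 2)
    fun φ => ?_) (by positivity)
  simp only
  have hp0 := hitProb_nonneg a (neighborMean φ x)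
  have hp := hitProb_le a (neighborMean φ x)
  have h1 := log_tilt_concave (α := Real.exp (b + h) - 1) (by linarith [Real.exp_pos (b + h)])
    hp0 hp hq (maxHit_lt_one a)
  have h2 := log_tilt_concave (α := Real.exp (-b + h) - 1) (by linarith [Real.exp_pos (-b + h)])
    hp0 hp hq (maxHit_lt_one a)
  have h3 : meanGain a b h * hitProb a (neighborMean φ x) =
      (hitProb a (neighborMean φ x) / maxHit a *
        Real.log (1 + (Real.exp (b + h) - 1) * maxHit a) +
      hitProb a (neighborMean φ x) / maxHit a *
        Real.log (1 + (Real.exp (-b + h) - 1) * maxHit a)) / 2 := by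
    rw [meanGain]; field_simp
  rw [h3]
  linarith

/-- Fluctuations of the environment outweigh a small negative mean: the two signs contribute
`log ((1 + p (e ^ b - 1)) (1 + p (e ^ (-b) - 1))) = log (1 + p (1 - p) (2 cosh b - 2))`. -/
lemma meanGain_ge {a : ℝ} (ha : 0 < a) (b : ℝ) {h : ℝ} (hh : h ≤ 0) :
    (h + Real.log (1 + maxHit a * (1 - maxHit a) * (2 * Real.cosh b - 2)) / 2) / maxHit a ≤
      meanGain a b h := by
  have hq := maxHit_pos ha
  have hq1 := maxHit_lt_one a
  set q := maxHit a with hqdef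
  have hfac : ∀ v : ℝ, h + Real.log (1 + (Real.exp v - 1) * q) ≤
      Real.log (1 + (Real.exp (v + h) - 1) * q) := by
    intro v
    have hp := one_add_mul_pos hq.le hq1 (α := Real.exp v - 1) (by linarith [Real.exp_pos v])
    rw [← Real.log_exp h, ← Real.log_mul (Real.exp_pos _).ne' hp.ne', Real.log_exp h]
    refine Real.log_le_log (mul_pos (Real.exp_pos _) hp) ?_
    rw [Real.exp_add]
    have := Real.exp_le_one_iff.mpr hh
    nlinarith
  have h1 := hfac b
  have h2 := hfac (-b)
  have hp1 := one_add_mul_pos hq.le hq1 (α := Real.exp b - 1) (by linarith [Real.exp_pos b])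
  have hp2 := one_add_mul_pos hq.le hq1 (α := Real.exp (-b) - 1) (by linarith [Real.exp_pos (-b)])
  have h3 : 1 + q * (1 - q) * (2 * Real.cosh b - 2) =
      (1 + (Real.exp b - 1) * q) * (1 + (Real.exp (-b) - 1) * q) := by
    have : Real.exp b * Real.exp (-b) = 1 := by rw [← Real.exp_add]; simp
    rw [Real.cosh_eq]
    linear_combination (-q ^ 2) * this
  rw [h3, Real.log_mul hp1.ne' hp2.ne', meanGain, div_le_div_iff₀ hq (by positivity)]
  nlinarith

/-! ### The environment -/

instance : IsProbabilityMeasure (envLaw d) := by unfold envLaw; infer_instance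

/-- The configuration `e` takes only the values `1` and `-1`. -/
def IsSigns (e : Site d → ℝ) : Prop := ∀ x, e x = 1 ∨ e x = -1

lemma map_neg_signLaw : signLaw.map (fun s => -s) = signLaw := by
  refine Measure.ext_of_lintegral _ fun f hf => ?_
  rw [lintegral_map hf measurable_neg]
  simp only [signLaw, bernoulliMeasure_def, lintegral_add_measure,
    MeasureTheory.lintegral_smul_measure, lintegral_dirac, neg_neg]
  rw [add_comm]
  congr 2 <;> · ext; simp; norm_num

lemma ae_signLaw : ∀ᵐ s ∂signLaw, s = 1 ∨ s = -1 := by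
  have hm : MeasurableSet {s : ℝ | ¬(s = 1 ∨ s = -1)} := by
    have : {s : ℝ | ¬(s = 1 ∨ s = -1)} = {1, -1}ᶜ := by ext; simp
    rw [this]
    exact (Set.toFinite {(1 : ℝ), -1}).measurableSet.compl
  rw [ae_iff, signLaw]
  exact bernoulliMeasure_apply_of_notMem_of_notMem _ hm (by simp) (by simp)

lemma map_eval_envLaw (x : Site d) : (envLaw d).map (fun e => e x) = signLaw :=
  Measure.infinitePi_map_eval _ x

lemma ae_isSigns : ∀ᵐ e ∂envLaw d, IsSigns e := by
  refine ae_all_iff.mpr fun x => ?_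
  have h := ae_signLaw
  rw [← map_eval_envLaw x] at h
  exact ae_of_ae_map (measurable_pi_apply x).aemeasurable h

lemma integral_eval_envLaw (g : ℝ → ℝ) (hg : Measurable g) (x : Site d) :
    ∫ e, g (e x) ∂envLaw d = (g 1 + g (-1)) / 2 := by
  rw [← integral_map (φ := fun e : Site d → ℝ => e x) (f := g)
    (measurable_pi_apply x).aemeasurable hg.aestronglyMeasurable, map_eval_envLaw, signLaw,
    integral_bernoulliMeasure]
  simp only [smul_eq_mul]
  ring

/-- Flip the sign of the environment at one site. -/
def flip (x : Site d) (e : Site d → ℝ) : Site d → ℝ := fun y => if y = x then -e y else e y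

@[fun_prop]
lemma measurable_flip (x : Site d) : Measurable (flip x) := by
  refine measurable_pi_lambda _ fun y => ?_
  unfold flip
  split_ifs <;> fun_prop

lemma IsSigns.flip {e : Site d → ℝ} (he : IsSigns e) (x : Site d) : IsSigns (flip x e) := by
  intro y
  unfold PinnedGFF.flip
  split_ifs
  · rcases he y with h | h <;> simp [h]
  · exact he y

lemma measurePreserving_flip (x : Site d) :
    MeasurePreserving (flip x) (envLaw d) (envLaw d) := by
  refine ⟨measurable_flip x, ?_⟩
  have h := Measure.infinitePi_map_pi (μ := fun _ : Site d => signLaw)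
    (f := fun y s => if y = x then -s else s) (fun y => by
      by_cases h : y = x <;> simp only [h, if_true, if_false] <;> fun_prop)
  refine Eq.trans h ?_
  unfold envLaw
  congr 1
  ext1 y
  by_cases h : y = x
  · simp only [h, if_true, map_neg_signLaw]
  · simp only [h, if_false, Measure.map_id']

lemma measurePreserving_translate (z : Site d) :
    MeasurePreserving (fun (e : Site d → ℝ) y => e (y + z)) (envLaw d) (envLaw d) := by
  refine ⟨by fun_prop, ?_⟩
  have h := Measure.infinitePi_map_piCongrLeft (X := fun _ : Site d => ℝ)
    (fun _ : Site d => signLaw) (Equiv.subRight z)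
  refine Eq.trans ?_ h
  rw [envLaw]
  congr 1
  ext e y
  simp [MeasurableEquiv.coe_piCongrLeft, Equiv.piCongrLeft_apply]

/-- A function of finitely many independent signs whose value changes by at most `2c` when one sign
is flipped has variance at most `c²` times the number of signs: averaging over a flip loses at most
`c²` of the second moment. -/
lemma integral_sq_le_of_flip (Λ : Finset (Site d)) {F : (Site d → ℝ) → ℝ} (hF : Measurable F)
    {M c : ℝ} (hM : ∀ e, IsSigns e → |F e| ≤ M)
    (hdep : ∀ e e', IsSigns e → IsSigns e' → (∀ x ∈ Λ, e x = e' x) → F e = F e')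
    (hc : ∀ e x, IsSigns e → |F e - F (flip x e)| ≤ 2 * c) :
    ∫ e, F e ^ 2 ∂envLaw d ≤ (∫ e, F e ∂envLaw d) ^ 2 + Λ.card * c ^ 2 := by
  induction Λ using Finset.induction generalizing F with
  | empty =>
    have h1 : ∀ᵐ e ∂envLaw d, F e = F fun _ => 1 := by
      filter_upwards [ae_isSigns] with e he
      exact hdep _ _ he (fun _ => Or.inl rfl) (by simp)
    have h2 : ∫ e, F e ∂envLaw d = F fun _ => 1 := by
      rw [integral_congr_ae h1]; simp
    have h3 : ∫ e, F e ^ 2 ∂envLaw d = (F fun _ => 1) ^ 2 := by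
      rw [integral_congr_ae (g := fun _ => (F fun _ => 1) ^ 2)
        (by filter_upwards [h1] with e he; rw [he])]
      simp
    simp [h2, h3]
  | insert x Λ hx ih =>
    have hint : ∀ {G : (Site d → ℝ) → ℝ} (_ : Measurable G) (C : ℝ),
        (∀ e, IsSigns e → |G e| ≤ C) → Integrable G (envLaw d) := fun hG C hC =>
      Integrable.of_bound hG.aestronglyMeasurable C (by
        filter_upwards [ae_isSigns] with e he using hC e he)
    have hsq : ∀ {r C : ℝ}, |r| ≤ C → |r ^ 2| ≤ C ^ 2 := fun h => by
      rw [abs_pow]; exact pow_le_pow_left₀ (abs_nonneg _) h 2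
    have hT : ∀ {G : (Site d → ℝ) → ℝ}, Measurable G →
        ∫ e, G (flip x e) ∂envLaw d = ∫ e, G e ∂envLaw d := fun {G} hG => by
      conv_rhs => rw [← (measurePreserving_flip x).map_eq]
      rw [integral_map (measurable_flip x).aemeasurable hG.aestronglyMeasurable]
    set A : (Site d → ℝ) → ℝ := fun e => (F e + F (flip x e)) / 2 with hA
    set D : (Site d → ℝ) → ℝ := fun e => (F e - F (flip x e)) / 2 with hD
    have hAm : Measurable A := by fun_prop
    have hDm : Measurable D := by fun_prop
    have hFT : ∀ e, IsSigns e → |F (flip x e)| ≤ M := fun e he => hM _ (he.flip x)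
    have hAM : ∀ e, IsSigns e → |A e| ≤ M := fun e he => by
      have h1 := abs_le.mp (hM e he)
      have h2 := abs_le.mp (hFT e he)
      rw [hA, abs_le]; constructor <;> linarith
    have hDc : ∀ e, IsSigns e → |D e| ≤ c := fun e he => by
      have := hc e x he
      simp only [hD, abs_div, abs_two]; linarith
    have hEA : ∫ e, A e ∂envLaw d = ∫ e, F e ∂envLaw d := by
      simp only [hA]
      rw [integral_div, integral_add (hint hF M hM) (hint (by fun_prop) M hFT), hT hF]
      ring
    have hE2 : ∫ e, F e ^ 2 ∂envLaw d = ∫ e, A e ^ 2 ∂envLaw d + ∫ e, D e ^ 2 ∂envLaw d := by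
      have iF := hint (hF.pow_const 2) (M ^ 2) fun e he => hsq (hM e he)
      have iFT : Integrable (fun e => F (flip x e) ^ 2) (envLaw d) :=
        hint (by fun_prop) (M ^ 2) fun e he => hsq (hFT e he)
      have h1 := hT (hF.pow_const 2)
      rw [← integral_add (hint (hAm.pow_const 2) (M ^ 2) fun e he => hsq (hAM e he))
        (hint (hDm.pow_const 2) (c ^ 2) fun e he => hsq (hDc e he))]
      have h2 : ∀ e, A e ^ 2 + D e ^ 2 = (F e ^ 2 + F (flip x e) ^ 2) / 2 := fun e => by
        simp only [hA, hD]; ring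
      simp only [h2]
      rw [integral_div, integral_add iF iFT, h1]
      ring
    have hDle : ∫ e, D e ^ 2 ∂envLaw d ≤ c ^ 2 := by
      have := integral_mono_ae (hint (hDm.pow_const 2) (c ^ 2) fun e he => hsq (hDc e he))
        (integrable_const (c ^ 2)) (by
          filter_upwards [ae_isSigns] with e he
          exact (le_abs_self _).trans (hsq (hDc e he)))
      simpa using this
    have hind := ih hAm hAM ?_ ?_
    · rw [hE2, Finset.card_insert_of_notMem hx]
      rw [hEA] at hind
      push_cast
      linarith
    · intro e e' he he' h
      have h0 : e' x = e x ∨ e' x = -e x := by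
        rcases he x with h1 | h1 <;> rcases he' x with h2 | h2 <;> simp [h1, h2]
      rcases h0 with h0 | h0
      · have h1 := hdep e e' he he' (fun y hy => by
          rcases Finset.mem_insert.mp hy with rfl | hy
          · exact h0.symm
          · exact h y hy)
        have h2 := hdep (flip x e) (flip x e') (he.flip x) (he'.flip x) (fun y hy => by
          rcases Finset.mem_insert.mp hy with rfl | hy
          · simp [flip, h0]
          · simp [flip, h y hy])
        simp only [hA, h1, h2]
      · have h1 := hdep e (flip x e') he (he'.flip x) (fun y hy => by
          rcases Finset.mem_insert.mp hy with rfl | hy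
          · simp [flip, h0]
          · have : y ≠ x := fun h => hx (h ▸ hy)
            simp [flip, this, h y hy])
        have h2 := hdep (flip x e) e' (he.flip x) he' (fun y hy => by
          rcases Finset.mem_insert.mp hy with rfl | hy
          · simp [flip, h0]
          · have : y ≠ x := fun h => hx (h ▸ hy)
            simp [flip, this, h y hy])
        simp only [hA, h1, h2, add_comm]
    · intro e y he
      have hcomm : flip x (flip y e) = flip y (flip x e) := by
        ext w; unfold flip; split_ifs <;> simp_all
      have h1 := abs_le.mp (hc e y he)
      have h2 := abs_le.mp (hc (flip x e) y (he.flip x))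
      simp only [hA, hcomm, abs_le]
      constructor <;> linarith

lemma ae_tendsto_zero_of_summable {Ω : Type*} [MeasurableSpace Ω] {μ : Measure Ω}
    {g : ℕ → Ω → ℝ} (hg : ∀ n, Measurable (g n)) {u : ℕ → ℝ} (hu : Summable u) (hu0 : ∀ n, 0 ≤ u n)
    (h : ∀ n, ∫⁻ ω, ENNReal.ofReal (g n ω ^ 2) ∂μ ≤ ENNReal.ofReal (u n)) :
    ∀ᵐ ω ∂μ, Tendsto (fun n => g n ω) atTop (𝓝 0) := by
  have h1 : ∫⁻ ω, ∑' n, ENNReal.ofReal (g n ω ^ 2) ∂μ ≠ ∞ := by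
    rw [lintegral_tsum fun n => ((hg n).pow_const 2).ennreal_ofReal.aemeasurable]
    refine ne_top_of_le_ne_top ?_ (ENNReal.tsum_le_tsum h)
    rw [← ENNReal.ofReal_tsum_of_nonneg hu0 hu]
    exact ENNReal.ofReal_ne_top
  have h2 := ae_lt_top' (Measurable.aemeasurable (by fun_prop)) h1
  filter_upwards [h2] with ω hω
  have h3 := (ENNReal.tendsto_toReal ENNReal.zero_ne_top).comp
    (ENNReal.tendsto_atTop_zero_of_tsum_ne_top hω.ne)
  have h4 : Tendsto (fun n => g n ω ^ 2) atTop (𝓝 0) := by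
    refine h3.congr fun n => ?_
    simp [ENNReal.toReal_ofReal (sq_nonneg _)]
  have h5 := h4.sqrt
  simp only [Real.sqrt_sq_eq_abs, Real.sqrt_zero] at h5
  exact (tendsto_zero_iff_abs_tendsto_zero _).mpr h5

/-! ### The averaged free energy -/

/-- The random variable `log (Z^e_Λ / Z^0_Λ)`. -/
def envLog (Λ : Finset (Site d)) (a b h : ℝ) (e : Site d → ℝ) : ℝ :=
  logRatio Λ a fun x => b * e x + h

/-- The average of `log (Z^e_Λ / Z^0_Λ)` over the environment. -/
def meanLog (Λ : Finset (Site d)) (a b h : ℝ) : ℝ := ∫ e, envLog Λ a b h e ∂envLaw d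

lemma abs_envLog_sub_le [NeZero d] (Λ : Finset (Site d)) (a b h : ℝ) (e e' : Site d → ℝ) :
    |envLog Λ a b h e - envLog Λ a b h e'| ≤ ∑ x ∈ Λ, |b| * |e x - e' x| := by
  refine (abs_logRatio_sub_le Λ a _ _).trans (le_of_eq (Finset.sum_congr rfl fun x _ => ?_))
  rw [← abs_mul]; congr 1; ring

@[fun_prop]
lemma measurable_envLog [NeZero d] (Λ : Finset (Site d)) (a b h : ℝ) :
    Measurable (envLog Λ a b h) := by
  refine Continuous.measurable (continuous_iff_continuousAt.mpr fun e => ?_)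
  refine tendsto_iff_dist_tendsto_zero.mpr (squeeze_zero (fun _ => dist_nonneg)
    (fun e' => (Real.dist_eq _ _).trans_le (abs_envLog_sub_le Λ a b h e' e)) ?_)
  have hc : Continuous fun e' : Site d → ℝ => ∑ x ∈ Λ, |b| * |e' x - e x| := by fun_prop
  simpa using hc.tendsto e

lemma IsSigns.abs_eq {e : Site d → ℝ} (he : IsSigns e) (x : Site d) : |e x| = 1 := by
  rcases he x with h | h <;> simp [h]

lemma IsSigns.abs_potential_le {e : Site d → ℝ} (he : IsSigns e) (b h : ℝ) (x : Site d) :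
    |b * e x + h| ≤ |b| + |h| := by
  refine (abs_add_le _ _).trans ?_
  rw [abs_mul, he.abs_eq, mul_one]

lemma abs_envLog_le [NeZero d] (Λ : Finset (Site d)) (a b h : ℝ) {e : Site d → ℝ}
    (he : IsSigns e) : |envLog Λ a b h e| ≤ Λ.card * (|b| + |h|) := by
  refine (abs_logRatio_le Λ a _).trans ?_
  rw [← nsmul_eq_mul]
  exact Finset.sum_le_card_nsmul _ _ _ fun x _ => he.abs_potential_le b h x

lemma integrable_envLog [NeZero d] (Λ : Finset (Site d)) (a b h : ℝ) :
    Integrable (envLog Λ a b h) (envLaw d) :=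
  Integrable.of_bound (measurable_envLog Λ a b h).aestronglyMeasurable _ (by
    filter_upwards [ae_isSigns] with e he using abs_envLog_le Λ a b h he)

lemma abs_meanLog_le [NeZero d] (Λ : Finset (Site d)) (a b h : ℝ) :
    |meanLog Λ a b h| ≤ Λ.card * (|b| + |h|) := by
  have := norm_integral_le_of_norm_le_const (μ := envLaw d) (f := envLog Λ a b h)
    (C := Λ.card * (|b| + |h|)) (by
      filter_upwards [ae_isSigns] with e he using abs_envLog_le Λ a b h he)
  simpa [meanLog] using this

lemma meanLog_mono [NeZero d] (Λ : Finset (Site d)) (a b : ℝ) {h h' : ℝ} (hh : h ≤ h') :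
    meanLog Λ a b h ≤ meanLog Λ a b h' :=
  integral_mono (integrable_envLog Λ a b h) (integrable_envLog Λ a b h') fun e =>
    logRatio_mono fun x _ => by linarith

lemma meanLog_image [NeZero d] (Λ : Finset (Site d)) (z : Site d) (a b h : ℝ) :
    meanLog (Λ.image (· + z)) a b h = meanLog Λ a b h := by
  have hmp := measurePreserving_translate z
  rw [meanLog, meanLog]
  conv_rhs => rw [← hmp.map_eq]
  rw [integral_map hmp.measurable.aemeasurable
    (measurable_envLog Λ a b h).aestronglyMeasurable]
  refine integral_congr_ae (ae_of_all _ fun e => ?_)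
  simp only [envLog, logRatio_image]

lemma variance_envLog_le [NeZero d] (Λ : Finset (Site d)) (a b h : ℝ) :
    ∫⁻ e, ENNReal.ofReal ((envLog Λ a b h e - meanLog Λ a b h) ^ 2) ∂envLaw d ≤
      ENNReal.ofReal (Λ.card * b ^ 2) := by
  have hb : ∀ e, IsSigns e → |envLog Λ a b h e| ≤ Λ.card * (|b| + |h|) :=
    fun e he => abs_envLog_le Λ a b h he
  have hm := measurable_envLog Λ a b h
  have h1 := integral_sq_le_of_flip Λ hm (c := |b|) hb
    (fun e e' _ _ hee => logRatio_congr fun x hx => by rw [hee x hx])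
    (fun e x he => by
      refine (abs_envLog_sub_le Λ a b h e (flip x e)).trans ?_
      refine (Finset.sum_le_sum_of_subset_of_nonneg (Finset.subset_insert x Λ)
        fun _ _ _ => by positivity).trans ?_
      rw [Finset.sum_eq_single_of_mem x (Finset.mem_insert_self _ _)]
      · simp only [flip, if_true, sub_neg_eq_add]
        rw [← two_mul, abs_mul, he.abs_eq, abs_two]
        linarith
      · intro y _ hy; simp [flip, hy])
  have hi2 : Integrable (fun e => envLog Λ a b h e ^ 2) (envLaw d) :=
    Integrable.of_bound (hm.pow_const 2).aestronglyMeasurable ((Λ.card * (|b| + |h|)) ^ 2) (by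
      filter_upwards [ae_isSigns] with e he
      rw [Real.norm_eq_abs, abs_pow]
      exact pow_le_pow_left₀ (abs_nonneg _) (hb e he) 2)
  have hi := integrable_envLog Λ a b h
  have hexp : ∀ e, (envLog Λ a b h e - meanLog Λ a b h) ^ 2 =
      envLog Λ a b h e ^ 2 - 2 * meanLog Λ a b h * envLog Λ a b h e + meanLog Λ a b h ^ 2 :=
    fun e => by ring
  have hi3 : Integrable (fun e => envLog Λ a b h e ^ 2 - 2 * meanLog Λ a b h * envLog Λ a b h e)
      (envLaw d) := hi2.sub (hi.const_mul _)
  have hi4 : Integrable (fun e => (envLog Λ a b h e - meanLog Λ a b h) ^ 2) (envLaw d) := by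
    simp only [hexp]
    exact hi3.add (integrable_const _)
  rw [← ofReal_integral_eq_lintegral_ofReal hi4 (ae_of_all _ fun _ => sq_nonneg _)]
  refine ENNReal.ofReal_le_ofReal ?_
  simp only [hexp]
  rw [integral_add hi3 (integrable_const _), integral_sub hi2 (hi.const_mul _),
    integral_const_mul]
  rw [sq_abs] at h1
  simp only [integral_const, probReal_univ, one_smul]
  change _ - 2 * meanLog Λ a b h * meanLog Λ a b h + meanLog Λ a b h ^ 2 ≤ _
  change _ ≤ meanLog Λ a b h ^ 2 + _ at h1
  linarith

/-- The averaged form of `logRatio_ge_resampled`: resampled sites earn `meanGain` per visit to the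
well, the others earn the mean `h` of the potential. -/
lemma meanLog_ge [NeZero d] {Λ T : Finset (Site d)} (hT : T ⊆ Λ)
    (hind : ∀ x ∈ T, ∀ i : Fin d, x + Pi.single i (1 : ℤ) ∉ T ∧ x - Pi.single i (1 : ℤ) ∉ T)
    {a : ℝ} (ha : 0 < a) (b h : ℝ) :
    meanGain a b h * ∑ x ∈ T, occupation Λ a 0 x + h * ∑ x ∈ Λ \ T, occupation Λ a 0 x ≤
      meanLog Λ a b h := by
  -- On sign configurations the site gain may be replaced by its affine interpolation.
  set L : (Site d → ℝ) → ℝ := fun e =>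
    ∑ x ∈ T, ((siteGain Λ a x (b + h) + siteGain Λ a x (-b + h)) / 2 +
      (siteGain Λ a x (b + h) - siteGain Λ a x (-b + h)) / 2 * e x) +
    ∑ x ∈ Λ \ T, (b * e x + h) * occupation Λ a 0 x with hL
  have hle : ∀ᵐ e ∂envLaw d, L e ≤ envLog Λ a b h e := by
    filter_upwards [ae_isSigns] with e he
    refine le_trans (le_of_eq ?_) (logRatio_ge_resampled hT hind a fun x => b * e x + h)
    simp only [hL]
    congr 1
    refine Finset.sum_congr rfl fun x _ => ?_
    rcases he x with h1 | h1
    · rw [h1, mul_one, mul_one]; ring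
    · rw [h1, mul_neg_one, mul_neg_one]; ring
  have hi0 : ∀ x : Site d, Integrable (fun e : Site d → ℝ => e x) (envLaw d) := fun x =>
    Integrable.of_bound (measurable_pi_apply x).aestronglyMeasurable 1 (by
      filter_upwards [ae_isSigns] with e he using (he.abs_eq x).le)
  have he0 : ∀ x : Site d, ∫ e, e x ∂envLaw d = 0 := fun x => by
    have := integral_eval_envLaw id measurable_id x
    simpa using this
  have hi1 : ∀ x ∈ T, Integrable (fun e : Site d → ℝ =>
      (siteGain Λ a x (b + h) + siteGain Λ a x (-b + h)) / 2 +
      (siteGain Λ a x (b + h) - siteGain Λ a x (-b + h)) / 2 * e x) (envLaw d) := fun x _ =>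
    (integrable_const _).add ((hi0 x).const_mul _)
  have hi2 : ∀ x ∈ Λ \ T, Integrable (fun e : Site d → ℝ =>
      (b * e x + h) * occupation Λ a 0 x) (envLaw d) := fun x _ =>
    (((hi0 x).const_mul b).add (integrable_const h)).mul_const _
  have hI : ∫ e, L e ∂envLaw d =
      ∑ x ∈ T, (siteGain Λ a x (b + h) + siteGain Λ a x (-b + h)) / 2 +
        ∑ x ∈ Λ \ T, h * occupation Λ a 0 x := by
    simp only [hL]
    rw [integral_add (integrable_finsetSum _ hi1) (integrable_finsetSum _ hi2),
      integral_finsetSum _ hi1, integral_finsetSum _ hi2]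
    congr 1
    · refine Finset.sum_congr rfl fun x _ => ?_
      rw [integral_add (integrable_const _) ((hi0 x).const_mul _), integral_const_mul, he0]
      simp
    · refine Finset.sum_congr rfl fun x _ => ?_
      rw [integral_mul_const, integral_add ((hi0 x).const_mul b) (integrable_const h),
        integral_const_mul, he0]
      simp
  have hmono := integral_mono_ae
    ((integrable_finsetSum _ hi1).add (integrable_finsetSum _ hi2)) (integrable_envLog Λ a b h) hle
  have hmono' : ∫ e, L e ∂envLaw d ≤ meanLog Λ a b h := hmono
  rw [hI] at hmono'
  refine le_trans ?_ hmono'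
  rw [Finset.mul_sum, Finset.mul_sum]
  gcongr with x hx
  exact siteGain_add_ge (hT hx) ha b h

/-! ### Boxes and blocks -/

lemma mem_box {n : ℕ} {x : Site d} : x ∈ box d n ↔ ∀ i, 0 ≤ x i ∧ x i < n := by
  simp [box, Fintype.mem_piFinset]

lemma card_box (n : ℕ) : (box d n).card = n ^ d := by
  simp [box, Fintype.card_piFinset]

/-- The translate by `(L + 1) j` of the box of side `L`. -/
def block (d L : ℕ) (j : Site d) : Finset (Site d) :=
  (box d L).image (· + fun i => ((L : ℤ) + 1) * j i)

lemma mem_block {L : ℕ} {j x : Site d} :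
    x ∈ block d L j ↔ ∀ i, ((L : ℤ) + 1) * j i ≤ x i ∧ x i < ((L : ℤ) + 1) * j i + L := by
  simp only [block, Finset.mem_image, mem_box]
  constructor
  · rintro ⟨y, hy, rfl⟩ i
    have := hy i
    simp only [Pi.add_apply]
    constructor <;> linarith
  · intro h
    refine ⟨x - fun i => ((L : ℤ) + 1) * j i, fun i => ?_, by simp⟩
    have := h i
    simp only [Pi.sub_apply]
    constructor <;> linarith

/-- Distinct blocks are separated by walls of width one. -/
lemma eq_of_mem_block {L : ℕ} {j k x y : Site d} (hx : x ∈ block d L j) (hy : y ∈ block d L k)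
    (h : ∀ i, |x i - y i| ≤ 1) : j = k := by
  rw [mem_block] at hx hy
  ext i
  have h1 := hx i
  have h2 := hy i
  have h3 := abs_le.mp (h i)
  by_contra hne
  rcases lt_or_gt_of_ne hne with hlt | hlt
  · have : ((L : ℤ) + 1) * (j i + 1) ≤ ((L : ℤ) + 1) * k i :=
      mul_le_mul_of_nonneg_left (by omega) (by positivity)
    linarith
  · have : ((L : ℤ) + 1) * (k i + 1) ≤ ((L : ℤ) + 1) * j i :=
      mul_le_mul_of_nonneg_left (by omega) (by positivity)
    linarith

lemma mem_biUnion_block {L m : ℕ} {x : Site d} :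
    x ∈ (box d m).biUnion (block d L) ↔
      ∀ i, 0 ≤ x i ∧ x i < (m : ℤ) * (L + 1) ∧ x i % (L + 1) < L := by
  simp only [Finset.mem_biUnion, mem_block, mem_box]
  have hL : (0 : ℤ) < (L : ℤ) + 1 := by positivity
  constructor
  · rintro ⟨j, hj, h⟩ i
    have h1 := h i
    have h2 := hj i
    have h3 : 0 ≤ ((L : ℤ) + 1) * j i := mul_nonneg hL.le h2.1
    have h4 : ((L : ℤ) + 1) * (j i + 1) ≤ ((L : ℤ) + 1) * m :=
      mul_le_mul_of_nonneg_left (by omega) hL.le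
    refine ⟨by linarith, by linarith, ?_⟩
    have h5 : x i % (L + 1) = x i - ((L : ℤ) + 1) * j i := by
      have : x i = (x i - ((L : ℤ) + 1) * j i) + ((L : ℤ) + 1) * j i := by ring
      conv_lhs => rw [this]
      rw [Int.add_mul_emod_self_left]
      exact Int.emod_eq_of_lt (by linarith) (by linarith)
    linarith
  · intro h
    refine ⟨fun i => x i / (L + 1), fun i => ⟨Int.ediv_nonneg (h i).1 hL.le, ?_⟩, fun i => ?_⟩
    · exact Int.ediv_lt_of_lt_mul hL (h i).2.1
    · have h1 := Int.mul_ediv_add_emod (x i) (L + 1)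
      have h2 := Int.emod_nonneg (x i) hL.ne'
      constructor <;> linarith [(h i).2.2]

lemma card_biUnion_block (L m : ℕ) :
    ((box d m).biUnion (block d L)).card = m ^ d * L ^ d := by
  rw [Finset.card_biUnion]
  · have : ∀ j ∈ box d m, (block d L j).card = L ^ d := fun j _ => by
      rw [block, Finset.card_image_of_injective _ (add_left_injective _), card_box]
    rw [Finset.sum_congr rfl this, Finset.sum_const, card_box, smul_eq_mul]
  · intro j _ k _ hjk
    refine Finset.disjoint_left.mpr fun x hx hx' => hjk (eq_of_mem_block hx hx' fun i => by simp)

/-- Approximate superadditivity of the averaged logarithm. -/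
lemma meanLog_box_ge [NeZero d] (hd : 2 ≤ d) {L m n : ℕ} (hmn : m * (L + 1) ≤ n) (a b h : ℝ) :
    (m : ℝ) ^ d * meanLog (box d L) a b h -
      (|b| + |h| + Real.log (2 * d)) * ((n : ℝ) ^ d - m ^ d * L ^ d) ≤
      meanLog (box d n) a b h := by
  set U := (box d m).biUnion (block d L) with hU
  set K := |b| + |h| + Real.log (2 * d) with hK
  have hUn : U ⊆ box d n := by
    intro x hx
    rw [hU, mem_biUnion_block] at hx
    rw [mem_box]
    have : (m : ℤ) * (L + 1) ≤ n := by exact_mod_cast hmn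
    exact fun i => ⟨(hx i).1, (hx i).2.1.trans_le this⟩
  have hsd : box d n \ (box d n \ U) = U := by
    exact Finset.sdiff_sdiff_eq_self hUn
  have hcard : ((box d n \ U).card : ℝ) = (n : ℝ) ^ d - m ^ d * L ^ d := by
    rw [Finset.card_sdiff_of_subset hUn, Nat.cast_sub (Finset.card_le_card hUn), card_box,
      card_biUnion_block]
    push_cast; ring
  -- A wall site stays in its wall when it moves in a direction parallel to the wall.
  have hadj : ∀ x ∈ box d n \ U, ∃ i : Fin d,
      x + Pi.single i (1 : ℤ) ∉ box d n \ (box d n \ U) := by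
    intro x hx
    rw [hsd]
    have hxU := (Finset.mem_sdiff.mp hx).2
    rw [hU, mem_biUnion_block] at hxU
    push Not at hxU
    obtain ⟨i, hi⟩ := hxU
    obtain ⟨j, hj⟩ : ∃ j : Fin d, j ≠ i :=
      haveI : Nontrivial (Fin d) := Fin.nontrivial_iff_two_le.mpr hd
      exists_ne i
    refine ⟨j, fun hc => ?_⟩
    rw [hU, mem_biUnion_block] at hc
    have h1 := hc i
    have h2 : (x + (Pi.single j 1 : Site d)) i = x i := by simp [hj.symm]
    rw [h2] at h1
    exact absurd (hi h1.1 h1.2.1) (not_le.mpr h1.2.2)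
  have hstep : ∀ y : Site d, ∀ i l : Fin d, |y l - (y + (Pi.single i 1 : Site d)) l| ≤ 1 ∧
      |y l - (y - (Pi.single i 1 : Site d)) l| ≤ 1 := by
    intro y i l
    by_cases hl : l = i
    · subst hl; simp
    · simp [hl]
  have key : ∀ᵐ e ∂envLaw d, ∑ j ∈ box d m, envLog (block d L j) a b h e -
      K * ((n : ℝ) ^ d - m ^ d * L ^ d) ≤ envLog (box d n) a b h e := by
    filter_upwards [ae_isSigns] with e he
    have h1 := logRatio_sdiff_le (box d n \ U) Finset.sdiff_subset hadj (a := a)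
      (v := fun x => b * e x + h) fun x => he.abs_potential_le b h x
    rw [hsd, hcard, hU, logRatio_biUnion] at h1
    · exact h1
    · intro j _ k _ hjk
      refine ⟨Finset.disjoint_left.mpr fun x hx hx' =>
        hjk (eq_of_mem_block hx hx' fun i => by simp), fun x hx i => ⟨fun hx' => ?_, fun hx' => ?_⟩⟩
      · exact hjk (eq_of_mem_block hx hx' fun l => (hstep x i l).1)
      · exact hjk (eq_of_mem_block hx hx' fun l => (hstep x i l).2)
  have hi : ∀ j ∈ box d m, Integrable (envLog (block d L j) a b h) (envLaw d) :=
    fun j _ => integrable_envLog _ a b h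
  have h2 := integral_mono_ae ((integrable_finsetSum _ hi).sub (integrable_const _))
    (integrable_envLog (box d n) a b h) key
  have h3 : ∫ e, (∑ j ∈ box d m, envLog (block d L j) a b h e -
      K * ((n : ℝ) ^ d - m ^ d * L ^ d)) ∂envLaw d =
      (m : ℝ) ^ d * meanLog (box d L) a b h - K * ((n : ℝ) ^ d - m ^ d * L ^ d) := by
    rw [integral_sub (integrable_finsetSum _ hi) (integrable_const _), integral_finsetSum _ hi]
    have : ∀ j ∈ box d m, ∫ e, envLog (block d L j) a b h e ∂envLaw d =
        meanLog (box d L) a b h := fun j _ => meanLog_image _ _ a b h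
    rw [Finset.sum_congr rfl this, Finset.sum_const, card_box]
    simp
  rw [← h3]
  exact h2

/-- Fekete's lemma in the form needed for boxes separated by walls. -/
lemma tendsto_of_superadditive {d : ℕ} {u : ℕ → ℝ} {V K : ℝ} (hV : ∀ n, |u n| ≤ V)
    (h : ∀ L m n : ℕ, 0 < n → m * (L + 1) ≤ n →
      (m * L / n : ℝ) ^ d * (u L + K) - K ≤ u n) :
    ∃ f : ℝ, Tendsto u atTop (𝓝 f) ∧ ∀ L : ℕ, (L / (L + 1) : ℝ) ^ d * (u L + K) - K ≤ f := by
  have hbb : IsBoundedUnder (· ≥ ·) atTop u :=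
    isBoundedUnder_of ⟨-V, fun n => (abs_le.mp (hV n)).1⟩
  have hba : IsBoundedUnder (· ≤ ·) atTop u :=
    isBoundedUnder_of ⟨V, fun n => (abs_le.mp (hV n)).2⟩
  have hcob : IsCoboundedUnder (· ≥ ·) atTop u := hba.isCoboundedUnder_ge
  set f := liminf u atTop with hf
  have hg : ∀ L : ℕ, (L / (L + 1) : ℝ) ^ d * (u L + K) - K ≤ f := by
    intro L
    have h1 : Tendsto (fun n : ℕ => ((n / (L + 1) : ℕ) : ℝ) / n) atTop
        (𝓝 ((1 : ℝ) / (L + 1))) := by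
      have h2 : Tendsto (fun n : ℕ => ((⌊(1 / ((L : ℝ) + 1)) * (n : ℝ)⌋₊ : ℕ) : ℝ) / (n : ℝ)) atTop
          (𝓝 ((1 : ℝ) / (L + 1))) :=
        (tendsto_nat_floor_mul_div_atTop (by positivity)).comp tendsto_natCast_atTop_atTop
      refine h2.congr fun n => ?_
      congr 2
      rw [one_div_mul_eq_div]
      have := Nat.floor_div_natCast (n : ℝ) (L + 1)
      push_cast at this
      rw [this, Nat.floor_natCast]
    have h3 : Tendsto (fun n : ℕ => (((n / (L + 1) : ℕ) : ℝ) * L / n) ^ d * (u L + K) - K) atTop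
        (𝓝 ((L / (L + 1) : ℝ) ^ d * (u L + K) - K)) := by
      have h4 := ((h1.mul_const (L : ℝ)).pow d).mul_const (u L + K) |>.sub_const K
      have e1 : (1 : ℝ) / (L + 1) * L = L / (L + 1) := by ring
      rw [e1] at h4
      refine h4.congr fun n => ?_
      congr 3; ring
    rw [← h3.liminf_eq]
    refine liminf_le_liminf ?_ h3.isBoundedUnder_ge hcob
    filter_upwards [eventually_gt_atTop 0] with n hn
    exact h L (n / (L + 1)) n hn (Nat.div_mul_le_self n (L + 1))
  refine ⟨f, tendsto_order.mpr ⟨fun c hc => eventually_lt_of_lt_liminf hc hbb, fun c hc => ?_⟩, hg⟩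
  have h1 : Tendsto (fun L : ℕ => (f + K) / ((L : ℝ) / (L + 1)) ^ d - K) atTop (𝓝 f) := by
    have h2 : Tendsto (fun L : ℕ => (L : ℝ) / (L + 1)) atTop (𝓝 1) :=
      tendsto_natCast_div_add_atTop 1
    have h3 := (((tendsto_const_nhds (x := f + K)).div (h2.pow d) (by simp)).sub_const K)
    simpa using h3
  filter_upwards [h1.eventually_lt_const hc, eventually_gt_atTop 0] with L hL hL0
  refine lt_of_le_of_lt ?_ hL
  have hLpos : (0 : ℝ) < L := Nat.cast_pos.mpr hL0
  rw [le_sub_iff_add_le, le_div_iff₀ (by positivity)]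
  have := hg L
  linarith

lemma abs_meanLog_box_le [NeZero d] (a b h : ℝ) (n : ℕ) :
    |((n : ℝ) ^ d)⁻¹ * meanLog (box d n) a b h| ≤ |b| + |h| := by
  have h1 := abs_meanLog_le (box d n) a b h
  rw [card_box, Nat.cast_pow] at h1
  rw [abs_mul, abs_of_nonneg (by positivity : (0 : ℝ) ≤ ((n : ℝ) ^ d)⁻¹)]
  rcases (by positivity : (0 : ℝ) ≤ (n : ℝ) ^ d).eq_or_lt with h0 | h0
  · rw [← h0]; simp; positivity
  · rw [inv_mul_le_iff₀ h0]; exact h1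

/-- The quenched free energy exists, and every finite box gives a lower bound for it. -/
lemma exists_quenchedFreeEnergy [NeZero d] (hd : 2 ≤ d) (a b h : ℝ) :
    ∃ f : ℝ, IsQuenchedFreeEnergy d a b h f ∧
      Tendsto (fun n : ℕ => ((n : ℝ) ^ d)⁻¹ * meanLog (box d n) a b h) atTop (𝓝 f) ∧
      ∀ L : ℕ, 0 < L → meanLog (box d L) a b h -
        (|b| + |h| + Real.log (2 * d)) * (((L : ℝ) + 1) ^ d - L ^ d) ≤ ((L : ℝ) + 1) ^ d * f := by
  set K := |b| + |h| + Real.log (2 * d) with hK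
  obtain ⟨f, hf, hfL⟩ := tendsto_of_superadditive (d := d) (K := K)
    (abs_meanLog_box_le (d := d) a b h) fun L m n hn hmn => by
      have h1 := meanLog_box_ge hd hmn a b h
      rw [← hK] at h1
      have hn' : (0 : ℝ) < (n : ℝ) ^ d := by positivity
      rw [inv_mul_eq_div, inv_mul_eq_div, le_div_iff₀ hn', div_pow, mul_pow]
      rcases Nat.eq_zero_or_pos L with rfl | hL
      · have h0 : ((0 : ℕ) : ℝ) ^ d = 0 := by simp [NeZero.ne d]
        rw [h0] at h1 ⊢
        have h2 : meanLog (box d 0) a b h = 0 := by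
          have : box d 0 = ∅ := by
            rw [← Finset.card_eq_zero, card_box]; simp [NeZero.ne d]
          simp [meanLog, this, envLog, logRatio_empty]
        rw [h2] at h1
        simp only [mul_zero, zero_div, zero_mul, zero_sub] at h1 ⊢
        linarith
      · have hL' : (0 : ℝ) < (L : ℝ) ^ d := by positivity
        refine le_trans (le_of_eq ?_) h1
        field_simp
        ring
  refine ⟨f, ?_, hf, fun L hL => ?_⟩
  · have hcz : ∀ᵐ e ∂envLaw d, Tendsto (fun n : ℕ => ((n : ℝ) ^ d)⁻¹ *
        (envLog (box d n) a b h e - meanLog (box d n) a b h)) atTop (𝓝 0) := by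
      refine ae_tendsto_zero_of_summable (u := fun n : ℕ => b ^ 2 * (1 / (n : ℝ) ^ d))
        (fun n => by fun_prop) ((Real.summable_one_div_nat_pow.mpr (by omega)).mul_left _)
        (fun n => by positivity) fun n => ?_
      have hv := variance_envLog_le (box d n) a b h
      simp only [mul_pow]
      rw [lintegral_congr fun e => ENNReal.ofReal_mul (by positivity),
        lintegral_const_mul _ (by fun_prop)]
      refine (mul_le_mul_right hv _).trans ?_
      rw [← ENNReal.ofReal_mul (by positivity), card_box]
      refine ENNReal.ofReal_le_ofReal (le_of_eq ?_)
      push_cast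
      rcases (by positivity : (0 : ℝ) ≤ (n : ℝ) ^ d).eq_or_lt with h0 | h0
      · rw [← h0]; simp
      · field_simp
    rw [IsQuenchedFreeEnergy]
    filter_upwards [hcz] with e he
    have h1 := he.add hf
    rw [zero_add] at h1
    refine h1.congr fun n => ?_
    rw [finiteFreeEnergy_eq, card_box, envLog]
    push_cast
    ring
  · have h1 := hfL L
    have hL' : (0 : ℝ) < (L : ℝ) ^ d := by positivity
    have hL1 : (0 : ℝ) < ((L : ℝ) + 1) ^ d := by positivity
    have h2 := mul_le_mul_of_nonneg_left h1 hL1.le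
    refine le_trans (le_of_eq ?_) h2
    rw [div_pow]
    field_simp
    ring

/-! ### The free energy at strongly repulsive potentials -/

/-- Only the sites next to the boundary contribute to the energy of a plateau. -/
lemma hamiltonian_indicator_box_le [NeZero d] {n : ℕ} (hn : 2 ≤ n) :
    (hamiltonian (box d n) fun x => if x ∈ box d n then 1 else 0) ≤
      (n : ℝ) ^ d - ((n : ℝ) - 2) ^ d := by
  set u : Site d → ℝ := fun x => if x ∈ box d n then 1 else 0 with hu
  have hu0 : ∀ x, 0 ≤ u x := fun x => by simp only [hu]; split_ifs <;> norm_num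
  set I : Finset (Site d) := Fintype.piFinset fun _ : Fin d => Finset.Ico (1 : ℤ) ((n : ℤ) - 1)
    with hI
  have hIb : I ⊆ box d n := by
    intro x hx
    rw [hI, Fintype.mem_piFinset] at hx
    rw [mem_box]
    intro i
    have := Finset.mem_Ico.mp (hx i)
    constructor <;> omega
  have hcardI : (I.card : ℝ) = ((n : ℝ) - 2) ^ d := by
    rw [hI, Fintype.card_piFinset]
    simp only [Int.card_Ico, Finset.prod_const, Finset.card_univ, Fintype.card_fin]
    have : ((n : ℤ) - 1 - 1).toNat = n - 2 := by omega
    rw [this, Nat.cast_pow, Nat.cast_sub hn]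
    norm_num
  have hd : (d : ℝ) ≠ 0 := Nat.cast_ne_zero.mpr (NeZero.ne d)
  have hmean : ∀ x ∈ I, neighborMean u x = 1 := by
    intro x hx
    rw [hI, Fintype.mem_piFinset] at hx
    have h1 : ∀ i, u (x + Pi.single i 1) = 1 ∧ u (x - Pi.single i 1) = 1 := by
      intro i
      simp only [hu, ite_eq_left_iff, zero_ne_one, imp_false, not_not, mem_box]
      constructor <;> intro l <;> have := Finset.mem_Ico.mp (hx l) <;> by_cases hl : l = i
      · subst hl; simp; constructor <;> omega
      · simp [hl]; constructor <;> omega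
      · subst hl; simp; constructor <;> omega
      · simp [hl]; constructor <;> omega
    simp only [neighborMean, (h1 _).1, (h1 _).2]
    simp
    field_simp
    norm_num
  have hmean0 : ∀ x, 0 ≤ neighborMean u x := fun x =>
    mul_nonneg (by positivity) (Finset.sum_nonneg fun i _ => add_nonneg (hu0 _) (hu0 _))
  have h1 : ∑ x ∈ box d n, (u x - neighborMean u x) * u x ≤ ∑ x ∈ box d n \ I, (1 : ℝ) := by
    rw [← Finset.sum_sdiff hIb]
    have h2 : ∑ x ∈ I, (u x - neighborMean u x) * u x = 0 := by
      refine Finset.sum_eq_zero fun x hx => ?_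
      have : u x = 1 := by simp [hu, hIb hx]
      rw [hmean x hx, this]; ring
    rw [h2, add_zero]
    refine Finset.sum_le_sum fun x hx => ?_
    have : u x = 1 := by simp [hu, (Finset.mem_sdiff.mp hx).1]
    rw [this]; linarith [hmean0 x]
  have h2 : ∑ x ∈ box d n \ I, (1 : ℝ) = (n : ℝ) ^ d - ((n : ℝ) - 2) ^ d := by
    rw [Finset.sum_const, nsmul_eq_mul, mul_one, Finset.card_sdiff_of_subset hIb,
      Nat.cast_sub (Finset.card_le_card hIb), hcardI, card_box]
    push_cast; ring
  have h3 : (0 : ℝ) ≤ (n : ℝ) ^ d - ((n : ℝ) - 2) ^ d := by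
    rw [← h2]; exact Finset.sum_nonneg fun _ _ => zero_le_one
  rw [hamiltonian_eq_sum fun x hx => by simp [hu, hx]]
  linarith

/-- A nonpositive potential has free energy at most zero, and at least zero since the field can stay
at a large constant height at the cost of a surface term. -/
lemma isQuenchedFreeEnergy_zero_of_le [NeZero d] {a : ℝ} (ha : 0 < a) {b h : ℝ} (hb : |b| ≤ -h) :
    IsQuenchedFreeEnergy d a b h 0 := by
  rw [IsQuenchedFreeEnergy]
  filter_upwards [ae_isSigns] with e he
  set V := |b| + |h| with hV
  have hV0 : 0 ≤ V := by positivity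
  have hup : ∀ n, finiteFreeEnergy (box d n) a b h e ≤ 0 := by
    intro n
    rw [finiteFreeEnergy_eq]
    refine mul_nonpos_of_nonneg_of_nonpos (by positivity) ?_
    rw [← logRatio_zero (box d n) a]
    refine logRatio_mono fun x _ => ?_
    have := abs_le.mp hb
    rcases he x with h1 | h1 <;> rw [h1] <;> linarith
  have hlow : ∀ M, a < M → ∀ n : ℕ, 2 ≤ n →
      -(M ^ 2 * (1 - (((n : ℝ) - 2) / n) ^ d)) - V * (2 * a / (M - a)) ≤
        finiteFreeEnergy (box d n) a b h e := by
    intro M hM n hn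
    have h1 := logRatio_ge_of_shift (Λ := box d n) ha hM hV0
      (v := fun x => b * e x + h) fun x => he.abs_potential_le b h x
    have h2 := mul_le_mul_of_nonneg_left (hamiltonian_indicator_box_le (d := d) hn) (sq_nonneg M)
    rw [card_box] at h1
    push_cast at h1
    have hn0 : (0 : ℝ) < (n : ℝ) ^ d := by
      have : (0 : ℝ) < n := by exact_mod_cast (by omega : 0 < n)
      positivity
    rw [finiteFreeEnergy_eq, card_box, inv_mul_eq_div]
    push_cast
    rw [le_div_iff₀ hn0, div_pow]
    have h3 : (-(M ^ 2 * (1 - ((n : ℝ) - 2) ^ d / (n : ℝ) ^ d)) - V * (2 * a / (M - a))) *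
        (n : ℝ) ^ d = -(M ^ 2 * ((n : ℝ) ^ d - ((n : ℝ) - 2) ^ d)) -
          V * (n : ℝ) ^ d * (2 * a / (M - a)) := by
      field_simp
    rw [h3]
    linarith
  refine tendsto_order.mpr ⟨fun c hc => ?_, fun c hc =>
    Eventually.of_forall fun n => (hup n).trans_lt hc⟩
  have hMlim : Tendsto (fun M : ℝ => V * (2 * a / (M - a))) atTop (𝓝 0) := by
    have h1 : Tendsto (fun M : ℝ => M - a) atTop atTop := tendsto_atTop_add_const_right _ _ tendsto_id
    simpa using (h1.const_div_atTop (2 * a)).const_mul V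
  obtain ⟨M, hM1, hM2⟩ := ((hMlim.eventually_lt_const (by linarith : (0 : ℝ) < -c)).and
    (eventually_gt_atTop a)).exists
  have hnlim : Tendsto (fun n : ℕ => -(M ^ 2 * (1 - (((n : ℝ) - 2) / n) ^ d)) -
      V * (2 * a / (M - a))) atTop (𝓝 (-(M ^ 2 * (1 - 1 ^ d)) - V * (2 * a / (M - a)))) := by
    have h1 : Tendsto (fun n : ℕ => ((n : ℝ) - 2) / n) atTop (𝓝 1) := by
      have h2 : Tendsto (fun n : ℕ => 1 - (2 : ℝ) / n) atTop (𝓝 (1 - 0)) :=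
        tendsto_const_nhds.sub (tendsto_const_div_atTop_nhds_zero_nat 2)
      rw [sub_zero] at h2
      refine h2.congr' ?_
      filter_upwards [eventually_gt_atTop 0] with n hn
      have : (n : ℝ) ≠ 0 := by positivity
      field_simp
    exact (((tendsto_const_nhds.sub (h1.pow d)).const_mul _).neg).sub_const _
  have hlim : c < -(M ^ 2 * (1 - 1 ^ d)) - V * (2 * a / (M - a)) := by
    rw [one_pow]; linarith
  filter_upwards [hnlim.eventually_const_lt hlim, eventually_ge_atTop 2] with n hn hn2
  exact hn.trans_le (hlow M hM2 n hn2)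

/-! ### Positivity of the quenched free energy -/

lemma one_add_pow_le {x : ℝ} (hx : 0 ≤ x) (hx1 : x ≤ 1) (n : ℕ) :
    (1 + x) ^ n ≤ 1 + (2 ^ n - 1) * x := by
  induction n with
  | zero => simp
  | succ n ih =>
    have h1 : (1 : ℝ) ≤ 2 ^ n := one_le_pow₀ (by norm_num)
    rw [pow_succ, pow_succ]
    nlinarith [mul_le_mul_of_nonneg_right ih (by linarith : (0 : ℝ) ≤ 1 + x),
      mul_nonneg (sub_nonneg.mpr h1) (mul_nonneg hx (sub_nonneg.mpr hx1))]

/-- The averaged reward in a box is at least of order `L ^ (d - 1/2)`: the even or the odd sublattice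
receives at least half of the visits to the well, and it is resampled. -/
lemma meanLog_box_ge_sqrt [NeZero d] {a : ℝ} (ha : 0 < a) {b h : ℝ} (hh : h ≤ 0)
    (hpos : 0 < meanGain a b h + h) (L : ℕ) :
    (meanGain a b h + h) / 2 * ((L : ℝ) ^ d *
      (2 * a * Real.exp (-a ^ 2 / 2) / √(4 * Real.pi * d * L))) ≤ meanLog (box d L) a b h := by
  set Λ := box d L with hΛ
  set o : Site d → ℝ := occupation Λ a 0 with ho
  have hocc : ∀ x ∈ Λ, 2 * a * Real.exp (-a ^ 2 / 2) / √(4 * Real.pi * d * L) ≤ o x := by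
    intro x hx
    refine occupation_ge hx (i := 0) (fun hk => ?_) ha
    have h1 := (mem_box.mp hk 0).2
    have h2 := (mem_box.mp hx 0).1
    simp at h1
    linarith
  have hsum : (L : ℝ) ^ d * (2 * a * Real.exp (-a ^ 2 / 2) / √(4 * Real.pi * d * L)) ≤
      ∑ x ∈ Λ, o x := by
    have := Finset.card_nsmul_le_sum _ _ _ hocc
    rwa [hΛ, card_box, nsmul_eq_mul, Nat.cast_pow] at this
  have hparity : ∀ (p : ℤ → Prop) [DecidablePred p], (∀ k, p k → ¬p (k + 1) ∧ ¬p (k - 1)) →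
      ∀ x ∈ Λ.filter (fun x => p (∑ i, x i)), ∀ i : Fin d,
        x + Pi.single i (1 : ℤ) ∉ Λ.filter (fun x => p (∑ i, x i)) ∧
          x - Pi.single i (1 : ℤ) ∉ Λ.filter (fun x => p (∑ i, x i)) := by
    intro p _ hp x hx i
    have h1 := hp _ (Finset.mem_filter.mp hx).2
    have h2 : ∑ l, (x + (Pi.single i 1 : Site d)) l = ∑ l, x l + 1 := by
      simp [Finset.sum_add_distrib]
    have h3 : ∑ l, (x - (Pi.single i 1 : Site d)) l = ∑ l, x l - 1 := by
      simp [Finset.sum_sub_distrib]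
    refine ⟨fun h => h1.1 ?_, fun h => h1.2 ?_⟩
    · rw [← h2]; exact (Finset.mem_filter.mp h).2
    · rw [← h3]; exact (Finset.mem_filter.mp h).2
  set A := Λ.filter (fun x => Even (∑ i, x i)) with hA
  set B := Λ.filter (fun x => ¬Even (∑ i, x i)) with hB
  have hAB : ∑ x ∈ A, o x + ∑ x ∈ B, o x = ∑ x ∈ Λ, o x := Finset.sum_filter_add_sum_filter_not _ _ _
  have hsA : ∑ x ∈ Λ \ A, o x = ∑ x ∈ B, o x := by
    rw [hA, ← Finset.filter_not]
  have hsB : ∑ x ∈ Λ \ B, o x = ∑ x ∈ A, o x := by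
    rw [hB, ← Finset.filter_not]; simp only [not_not, hA]
  have gA := meanLog_ge (T := A) (Finset.filter_subset _ _) (hparity (fun k => Even k)
    fun k hk => ⟨by rw [Int.even_add_one]; simpa using hk,
      by rw [Int.even_sub_one]; simpa using hk⟩) ha b h
  have gB := meanLog_ge (T := B) (Finset.filter_subset _ _) (hparity (fun k => ¬Even k)
    fun k hk => ⟨by rw [Int.even_add_one]; simpa using hk,
      by rw [Int.even_sub_one]; simpa using hk⟩) ha b h
  rw [hsA] at gA
  rw [hsB] at gB
  have h1 := mul_le_mul_of_nonneg_left hsum (by linarith : 0 ≤ (meanGain a b h + h) / 2)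
  refine h1.trans ?_
  rw [← hAB]
  rcases le_total (∑ x ∈ A, o x) (∑ x ∈ B, o x) with hle | hle
  · refine le_trans ?_ gB
    nlinarith
  · refine le_trans ?_ gA
    nlinarith

/-- The walls between boxes of side `L` cost an amount of order `L ^ (d - 1)` per box, which is
smaller than the reward of order `L ^ (d - 1/2)` when `L` is large. -/
lemma exists_quenchedFreeEnergy_pos [NeZero d] (hd : 2 ≤ d) {a : ℝ} (ha : 0 < a) {b h₀ h : ℝ}
    (hh₀ : h₀ ≤ 0) (hpos : 0 < meanGain a b h₀ + h₀) (hh : h₀ ≤ h) :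
    ∃ f : ℝ, IsQuenchedFreeEnergy d a b h f ∧ 0 < f := by
  obtain ⟨f, hfq, hft, -⟩ := exists_quenchedFreeEnergy hd a b h
  obtain ⟨f₀, -, hft₀, hfL⟩ := exists_quenchedFreeEnergy hd a b h₀
  refine ⟨f, hfq, ?_⟩
  have hmono : f₀ ≤ f := le_of_tendsto_of_tendsto' hft₀ hft fun n =>
    mul_le_mul_of_nonneg_left (meanLog_mono _ a b hh) (by positivity)
  refine lt_of_lt_of_le ?_ hmono
  have hd1 : (1 : ℝ) ≤ 2 * d := by
    have : (2 : ℝ) ≤ d := by exact_mod_cast hd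
    linarith
  have hdpos : (0 : ℝ) < d := by linarith
  set K := |b| + |h₀| + Real.log (2 * d) with hK
  have hK0 : 0 ≤ K := by have := Real.log_nonneg hd1; positivity
  set q := (meanGain a b h₀ + h₀) / 2 * (2 * a * Real.exp (-a ^ 2 / 2) / √(4 * Real.pi * d))
    with hq
  have hq0 : 0 < q := by positivity
  obtain ⟨L, hLbig⟩ := exists_nat_gt (max 1 ((K * 2 ^ d / q) ^ 2))
  have hL1 : (1 : ℝ) < L := (le_max_left _ _).trans_lt hLbig
  have hLpos : (0 : ℝ) < L := by linarith
  have hL0 : 0 < L := Nat.cast_pos.mp hLpos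
  have hsq : K * 2 ^ d / q < √L :=
    Real.lt_sqrt_of_sq_lt ((le_max_right _ _).trans_lt hLbig)
  rw [div_lt_iff₀ hq0] at hsq
  have h1 := meanLog_box_ge_sqrt (d := d) ha hh₀ hpos L
  have h2 : (meanGain a b h₀ + h₀) / 2 * ((L : ℝ) ^ d *
      (2 * a * Real.exp (-a ^ 2 / 2) / √(4 * Real.pi * d * L))) = (L : ℝ) ^ d / L * (√L * q) := by
    rw [Real.sqrt_mul (by positivity) (L : ℝ), hq]
    have h3 : √(L : ℝ) ^ 2 = L := Real.sq_sqrt hLpos.le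
    have h4 : √(L : ℝ) ≠ 0 := by positivity
    have h5 : √(4 * Real.pi * d) ≠ 0 := by positivity
    generalize √(L : ℝ) = r at *
    rw [← h3]
    field_simp
  rw [h2] at h1
  have h3 : ((L : ℝ) + 1) ^ d - (L : ℝ) ^ d ≤ (L : ℝ) ^ d / L * 2 ^ d := by
    have h4 := one_add_pow_le (x := 1 / (L : ℝ)) (by positivity)
      ((div_le_one hLpos).mpr hL1.le) d
    have h5 : ((L : ℝ) + 1) ^ d = (L : ℝ) ^ d * (1 + 1 / L) ^ d := by
      rw [← mul_pow]; congr 1; field_simp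
    have h6 := mul_le_mul_of_nonneg_left h4 (by positivity : (0 : ℝ) ≤ (L : ℝ) ^ d)
    have h7 : (L : ℝ) ^ d * (1 + (2 ^ d - 1) * (1 / (L : ℝ))) =
        (L : ℝ) ^ d + (L : ℝ) ^ d / L * 2 ^ d - (L : ℝ) ^ d / L := by ring
    have h8 : 0 ≤ (L : ℝ) ^ d / L := by positivity
    rw [h5]
    linarith
  have h4 := hfL L hL0
  have h5 := mul_le_mul_of_nonneg_left h3 hK0
  have h6 : (L : ℝ) ^ d / L * (K * 2 ^ d) < (L : ℝ) ^ d / L * (√L * q) :=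
    mul_lt_mul_of_pos_left hsq (by positivity)
  have h7 : 0 < ((L : ℝ) + 1) ^ d * f₀ := by
    refine lt_of_lt_of_le ?_ h4
    linarith
  exact (mul_pos_iff_of_pos_left (by positivity)).mp h7

lemma meanGain_add_pos {a : ℝ} (ha : 0 < a) {b h : ℝ} (hh : h ≤ 0)
    (hg : -2 * h < Real.log (1 + maxHit a * (1 - maxHit a) * (2 * Real.cosh b - 2)) / 2) :
    0 < meanGain a b h + h := by
  have hq := maxHit_pos ha
  have hq1 := maxHit_lt_one a
  have h1 := meanGain_ge ha b hh
  rw [div_le_iff₀ hq] at h1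
  have h2 : 0 < (meanGain a b h + h) * maxHit a := by nlinarith
  exact (mul_pos_iff_of_pos_right hq).mp h2

lemma isQuenchedFreeEnergy_le_of_le [NeZero d] {a b h h' f f' : ℝ} (hh : h ≤ h')
    (hf : IsQuenchedFreeEnergy d a b h f) (hf' : IsQuenchedFreeEnergy d a b h' f') : f ≤ f' := by
  obtain ⟨e, he, he'⟩ := (hf.and hf').exists
  refine le_of_tendsto_of_tendsto' he he' fun n => ?_
  rw [finiteFreeEnergy_eq, finiteFreeEnergy_eq]
  exact mul_le_mul_of_nonneg_left (logRatio_mono fun x _ => by linarith) (by positivity)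

lemma half_sq_le_cosh_sub_one (b : ℝ) : b ^ 2 ≤ 2 * Real.cosh b - 2 := by
  have h1 : Real.cosh b = 1 + 2 * Real.sinh (b / 2) ^ 2 := by
    have h := Real.cosh_two_mul (b / 2)
    rw [Real.cosh_sq, mul_div_cancel₀ b two_ne_zero] at h
    linarith
  have h2 : (b / 2) ^ 2 ≤ Real.sinh (b / 2) ^ 2 := by
    rw [sq_le_sq, Real.abs_sinh]
    exact Real.self_le_sinh_iff.mpr (abs_nonneg _)
  rw [h1]
  linarith

end PinnedGFF

end

open PinnedGFF in
theorem theorem1 (d : ℕ) (hd : 2 ≤ d) (a : ℝ) (ha : 0 < a) :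
    (∀ b : ℝ, 0 < b → ∃ hc : ℝ, PinnedGFF.IsQuenchedCriticalPoint d a b hc ∧ hc < 0) ∧
    ∃ C : ℝ, 0 < C ∧ ∃ C' : ℝ, 0 < C' ∧ ∃ ε : ℝ, 0 < ε ∧ ε < 1 ∧
      ∀ b h : ℝ, 0 < b + h → -ε < -b + h → -b + h < 0 →
        (d = 2 → h > C' * (-b + h) ^ 2 / Real.log (b - h)) →
        (3 ≤ d → h > -C * (-b + h) ^ 2) →
        ∃ f : ℝ, PinnedGFF.IsQuenchedFreeEnergy d a b h f ∧ 0 < f := by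
  have : NeZero d := ⟨by omega⟩
  have hq := maxHit_pos ha
  have hq1 := maxHit_lt_one a
  set q := maxHit a with hqdef
  have hqq : 0 < q * (1 - q) := mul_pos hq (by linarith)
  have hgpos : ∀ b : ℝ, 0 < b →
      0 < Real.log (1 + q * (1 - q) * (2 * Real.cosh b - 2)) / 2 := by
    intro b hb
    have h1 : 0 < 2 * Real.cosh b - 2 := (by positivity : (0 : ℝ) < b ^ 2).trans_le
      (half_sq_le_cosh_sub_one b)
    exact div_pos (Real.log_pos (by nlinarith [mul_pos hqq h1])) two_pos
  refine ⟨fun b hb => ?_, q * (1 - q) / 32, by positivity, q * (1 - q) / 32, by positivity,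
    Real.exp (-1), Real.exp_pos _, Real.exp_lt_one_iff.mpr (by norm_num), fun b h hbh hε hneg h2 h3 => ?_⟩
  · set g := Real.log (1 + q * (1 - q) * (2 * Real.cosh b - 2)) / 2 with hg
    have hg0 := hgpos b hb
    obtain ⟨f₀, hf₀, hf₀pos⟩ := exists_quenchedFreeEnergy_pos hd ha (b := b) (h₀ := -(g / 4))
      (h := -(g / 4)) (by linarith) (meanGain_add_pos ha (by linarith) (by rw [← hqdef]; linarith))
      le_rfl
    have hmem : -b ∈ {h : ℝ | IsQuenchedFreeEnergy d a b h 0} :=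
      isQuenchedFreeEnergy_zero_of_le ha (by rw [abs_of_pos hb, neg_neg])
    have hub : -(g / 4) ∈ upperBounds {h : ℝ | IsQuenchedFreeEnergy d a b h 0} := by
      intro h hh
      by_contra hlt
      have := isQuenchedFreeEnergy_le_of_le (not_le.mp hlt).le hf₀ hh
      linarith
    refine ⟨sSup {h : ℝ | IsQuenchedFreeEnergy d a b h 0}, isLUB_csSup ⟨_, hmem⟩ ⟨_, hub⟩, ?_⟩
    exact (csSup_le ⟨_, hmem⟩ hub).trans_lt (by linarith)
  · rcases le_or_gt 0 h with h0 | h0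
    · have hb : 0 < b := by linarith
      exact exists_quenchedFreeEnergy_pos hd ha le_rfl (meanGain_add_pos ha le_rfl (by
        rw [← hqdef]; linarith [hgpos b hb])) h0
    · -- In dimension two the hypothesis is stronger, because `log (b - h) < -1`.
      have hlow : -(q * (1 - q) / 32) * (-b + h) ^ 2 < h := by
        rcases Nat.lt_or_ge d 3 with hd3 | hd3
        · refine lt_of_le_of_lt ?_ (h2 (by omega))
          have hlog : Real.log (b - h) < -1 := by
            rw [Real.log_lt_iff_lt_exp (by linarith)]; linarith
          rw [le_div_iff_of_neg (by linarith)]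
          have : 0 ≤ q * (1 - q) / 32 * (-b + h) ^ 2 := by positivity
          nlinarith
        · exact h3 hd3
      have hb1 : b < 1 := by
        have : Real.exp (-1) < 1 := Real.exp_lt_one_iff.mpr (by norm_num)
        linarith
      have hb0 : 0 < b := by linarith
      refine exists_quenchedFreeEnergy_pos hd ha h0.le (meanGain_add_pos ha h0.le ?_) le_rfl
      rw [← hqdef]
      set y := q * (1 - q) * b ^ 2 with hy
      have hy0 : 0 < y := by positivity
      have hy1 : y ≤ 1 := by
        have h5 : q * (1 - q) ≤ 1 := by nlinarith
        have h6 : b ^ 2 ≤ 1 := by nlinarith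
        exact mul_le_one₀ h5 (sq_nonneg b) h6
      have hlogy : y / 2 ≤ Real.log (1 + y) := by
        have h5 := Real.one_sub_inv_le_log_of_pos (by linarith : 0 < 1 + y)
        refine le_trans ?_ h5
        have h6 : 1 - (1 + y)⁻¹ = y / (1 + y) := by field_simp; ring
        rw [h6]
        exact div_le_div_of_nonneg_left hy0.le (by linarith) (by linarith)
      have hlog2 : Real.log (1 + y) ≤ Real.log (1 + q * (1 - q) * (2 * Real.cosh b - 2)) :=
        Real.log_le_log (by linarith) (by
          have := mul_le_mul_of_nonneg_left (half_sq_le_cosh_sub_one b) hqq.le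
          linarith)
      have hsq : (-b + h) ^ 2 ≤ 4 * b ^ 2 := by nlinarith
      have h5 : q * (1 - q) / 32 * (-b + h) ^ 2 ≤ q * (1 - q) / 32 * (4 * b ^ 2) :=
        mul_le_mul_of_nonneg_left hsq (by positivity)
      have h6 : q * (1 - q) / 32 * (4 * b ^ 2) = y / 8 := by rw [hy]; ring
      linarith
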